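/- Let $m\ge 0$ and let $H_0=-i\,\frac{d}{dx}\,\sigma_1+m\,\sigma_3$, with $\sigma_1=\begin{pmatrix}0&1\\1&0\end{pmatrix}$ and $\sigma_3=\begin{pmatrix}1&0\\0&-1\end{pmatrix}$, be the free Dirac operator in $\mathcal H=L^2(\mathbb R)\otimes\mathbb C^2$ with domain $H^1(\mathbb R;\mathbb C^2)$, so that $\rho(H_0)=\mathbb C\setminus\big((-\infty,-m]\cup[m,\infty)\big)$. Write $R_0(z)=(H_0-z)^{-1}$ for $z\in\rho(H_0)$. Let $V=(V_{ij})_{i,j=1}^2$ be a matrix-valued function on $\mathbb R$ with entries $V_{ij}\in L^1(\mathbb R)+L^\infty_0(\mathbb R)$, where $L^\infty_0(\mathbb R)$ is the space of bounded measurable functions that vanish at infinity. Let $V(x)=U(x)|V(x)|$ be the pointwise polar decomposition, and let $A=|V|^{1/2}$ and $B=U|V|^{1/2}$, regarded as maximal multiplication operators in $\mathcal H$. Let $H$ be the closed extension of $H_0+V=H_0+BA$ with resolvent $$(H-z)^{-1}=R_0(z)-\overline{R_0(z)B}\,\big(I+Q(z)\big)^{-1}AR_0(z),\qquad Q(z)=\overline{AR_0(z)B},$$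 for $z\in\rho(H_0)$ such that $-1\in\rho(Q(z))$ (the bars denote bounded closures; $H$ does not depend on the point $z$ used to define it). For a $2\times2$ matrix let $\|\cdot\|$ be the operator norm on Euclidean $\mathbb C^2$. For $\varepsilon>0$ let $$C_\varepsilon=\inf\Big\{\int_{\mathbb R}\|W(x)\|\,dx \;:\; V=W+X,\ W_{ij}\in L^1(\mathbb R),\ \|X(x)\|\le\varepsilon \text{ for almost every } x\Big\}.$$ For $z\in\rho(H_0)$ and $s>0$ put $$\Phi(z)=\frac{z+m}{z-m},\qquad \eta(s)=\sqrt{\tfrac12+\tfrac14\,(s+s^{-1})},$$ and let $\sqrt{z^2-m^2}$ be the square root with positive imaginary part. Let $z\in\rho(H_0)$. If for some $\varepsilon>0$ $$C_\varepsilon<\eta(|\Phi(z)|)^{-1}$$ and $$\frac{1}{\operatorname{dist}(z,\sigma(H_0))}+\frac{\eta(|\Phi(z)|)^2}{\operatorname{Im}\sqrt{z^2-m^2}}\;\frac{C_\varepsilon}{1-\eta(|\Phi(z)|)\,C_\varepsilon}<\frac1\varepsilon,$$ then $z\notin\sigma(H)$. -/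

import Mathlib

open MeasureTheory
open scoped ContDiff Matrix ENNReal

namespace DiracSpec

noncomputable section

/-! ### Unbounded operators: resolvent set, spectrum, factorized perturbations -/

section Abstract

variable {E K : Type*} [NormedAddCommGroup E] [NormedSpace ℂ E]
  [NormedAddCommGroup K] [NormedSpace ℂ K]

/-- `R` is a bounded, everywhere defined, two-sided inverse of `T - z : dom T → E`. -/
def IsResolventAt (T : E →ₗ.[ℂ] E) (z : ℂ) (R : E →L[ℂ] E) : Prop :=
  (∀ g : E, ∃ h : R g ∈ T.domain, T ⟨R g, h⟩ - z • R g = g) ∧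
    ∀ f : T.domain, R (T f - z • (f : E)) = f

/-- A bounded inverse of `T - z` is unique. -/
theorem IsResolventAt.unique {T : E →ₗ.[ℂ] E} {z : ℂ} {R R' : E →L[ℂ] E}
    (h : IsResolventAt T z R) (h' : IsResolventAt T z R') : R = R' := by
  ext g
  obtain ⟨hd, hg⟩ := h.1 g
  have := h'.2 ⟨R g, hd⟩
  rw [hg] at this
  exact this.symm

/-- The resolvent set `ρ(T)` of an (unbounded) operator `T`. -/
def resolventSet (T : E →ₗ.[ℂ] E) : Set ℂ :=
  {z | ∃ R : E →L[ℂ] E, IsResolventAt T z R}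

/-- The spectrum `σ(T) = ℂ \ ρ(T)`. -/
def spectrum (T : E →ₗ.[ℂ] E) : Set ℂ :=
  (resolventSet T)ᶜ

open Classical in
/-- The resolvent `(T - z)⁻¹` for `z ∈ ρ(T)` (and `0` for `z ∉ ρ(T)`). -/
def resolvent (T : E →ₗ.[ℂ] E) (z : ℂ) : E →L[ℂ] E :=
  if h : z ∈ resolventSet T then h.choose else 0

theorem isResolventAt_resolvent {T : E →ₗ.[ℂ] E} {z : ℂ} (h : z ∈ resolventSet T) :
    IsResolventAt T z (resolvent T z) := by
  rw [resolvent, dif_pos h]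
  exact h.choose_spec

/-- Let `H₀`, `A`, `B` be closed and densely defined, and write `R₀(z) = (H₀ - z)⁻¹`. The relation
`IsPerturbedResolvent H₀ A B z R` says that `z ∈ ρ(H₀)`, that
* `A R₀(z)` is everywhere defined and bounded (it is `AR`),
* `R₀(z) B` has the bounded closure `RB` (the only bounded extension, as `dom B` is dense),
* `A R₀(z) B` has the bounded closure `Q = Q(z)`,
* `I + Q(z)` is boundedly invertible, i.e. `-1 ∈ ρ(Q(z))`,

and that `R = R₀(z) - RB (I + Q(z))⁻¹ AR`. -/
def IsPerturbedResolvent (H₀ : E →ₗ.[ℂ] E) (A : E →ₗ.[ℂ] K) (B : K →ₗ.[ℂ] E)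
    (z : ℂ) (R : E →L[ℂ] E) : Prop :=
  z ∈ resolventSet H₀ ∧
  ∃ (AR : E →L[ℂ] K) (RB : K →L[ℂ] E) (Q : K →L[ℂ] K),
    (∀ f : E, ∃ h : resolvent H₀ z f ∈ A.domain, A ⟨resolvent H₀ z f, h⟩ = AR f) ∧
    (∀ f : B.domain, resolvent H₀ z (B f) = RB f) ∧
    (∀ f : B.domain, ∃ h : resolvent H₀ z (B f) ∈ A.domain,
      A ⟨resolvent H₀ z (B f), h⟩ = Q f) ∧
    IsUnit (1 + Q) ∧
    R = resolvent H₀ z - RB ∘L (Ring.inverse (1 + Q)) ∘L AR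

open Classical in
/-- The closed extension `H` of `H₀ + B A` attached to a factorized perturbation: the operator
with `(H - z₀)⁻¹ = R₀(z₀) - cl(R₀(z₀) B) (I + Q(z₀))⁻¹ A R₀(z₀)`, that is,
`H = z₀ + (R₀(z₀) - cl(R₀(z₀) B) (I + Q(z₀))⁻¹ A R₀(z₀))⁻¹`, where `z₀` is any point of `ρ(H₀)`
at which the right-hand side makes sense (the operator does not depend on this point).
If there is no such `z₀`, it is the operator with domain `{0}`, whose spectrum is all
of `ℂ` unless `E = 0`. -/
def factorizedPerturbation (H₀ : E →ₗ.[ℂ] E) (A : E →ₗ.[ℂ] K) (B : K →ₗ.[ℂ] E) :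
    E →ₗ.[ℂ] E :=
  if h : ∃ p : ℂ × (E →L[ℂ] E), IsPerturbedResolvent H₀ A B p.1 p.2 then
    (h.choose.1 • (LinearMap.id : E →ₗ[ℂ] E)) +ᵥ
      ((h.choose.2 : E →ₗ[ℂ] E).toPMap ⊤).inverse
  else ⊥

end Abstract

/-! ### The free Dirac operator on the line -/

/-- The space `ℂ²` with its Euclidean norm. -/
abbrev C2 : Type := EuclideanSpace ℂ (Fin 2)

/-- The Hilbert space `L²(ℝ) ⊗ ℂ² = L²(ℝ; ℂ²)`. -/
abbrev Hil : Type := Lp C2 2 (volume : Measure ℝ)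

/-- The operator on Euclidean `ℂ²` defined by a `2 × 2` matrix; `‖matOp M‖` is the operator norm of
the matrix. -/
def matOp (M : Matrix (Fin 2) (Fin 2) ℂ) : C2 →L[ℂ] C2 :=
  Matrix.toEuclideanCLM (n := Fin 2) (𝕜 := ℂ) M

/-- The Pauli matrix `σ₁`. -/
def sigma1 : Matrix (Fin 2) (Fin 2) ℂ := !![0, 1; 1, 0]

/-- The Pauli matrix `σ₃`. -/
def sigma3 : Matrix (Fin 2) (Fin 2) ℂ := !![1, 0; 0, -1]

theorem Hil.locallyIntegrable (f : Hil) : LocallyIntegrable (f : ℝ → C2) volume :=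
  (Lp.memLp f).locallyIntegrable (by norm_num)

theorem integrable_test {φ : ℝ → ℝ} (h : Continuous φ) (hc : HasCompactSupport φ) (f : Hil) :
    Integrable (fun x => φ x • f x) volume :=
  (Hil.locallyIntegrable f).integrable_smul_left_of_hasCompactSupport h hc

/-- The pairs `(f, g)` in `L² × L²` such that `g` is the weak (distributional) derivative
of `f`. -/
def weakDerivGraph : Submodule ℂ (Hil × Hil) where
  carrier := {p | ∀ φ : ℝ → ℝ, ContDiff ℝ ∞ φ → HasCompactSupport φ →
    ∫ x, deriv φ x • p.1 x = -∫ x, φ x • p.2 x}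
  zero_mem' := by
    intro φ hφ hc
    rw [integral_congr_ae (g := fun _ => (0 : C2)), integral_congr_ae (g := fun _ => (0 : C2))]
    · simp
    · exact Filter.Eventually.of_forall fun x => by simp
    · exact Filter.Eventually.of_forall fun x => by simp
  add_mem' := by
    intro p q hp hq φ hφ hc
    have hd : Continuous (deriv φ) := hφ.continuous_deriv (by simp)
    have e1 : ∫ x, deriv φ x • (p + q).1 x
        = (∫ x, deriv φ x • p.1 x) + ∫ x, deriv φ x • q.1 x := by
      rw [← integral_add (integrable_test hd hc.deriv _) (integrable_test hd hc.deriv _)]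
      refine integral_congr_ae ?_
      filter_upwards [Lp.coeFn_add p.1 q.1] with x hx
      simp only [Prod.fst_add, hx, Pi.add_apply, smul_add]
    have e2 : ∫ x, φ x • (p + q).2 x = (∫ x, φ x • p.2 x) + ∫ x, φ x • q.2 x := by
      rw [← integral_add (integrable_test hφ.continuous hc _)
        (integrable_test hφ.continuous hc _)]
      refine integral_congr_ae ?_
      filter_upwards [Lp.coeFn_add p.2 q.2] with x hx
      simp only [Prod.snd_add, hx, Pi.add_apply, smul_add]
    rw [e1, e2, hp φ hφ hc, hq φ hφ hc, neg_add]
  smul_mem' := by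
    intro c p hp φ hφ hc
    have e1 : ∫ x, deriv φ x • (c • p).1 x = c • ∫ x, deriv φ x • p.1 x := by
      rw [← integral_smul]
      refine integral_congr_ae ?_
      filter_upwards [Lp.coeFn_smul c p.1] with x hx
      simp [hx, smul_comm c (deriv φ x)]
    have e2 : ∫ x, φ x • (c • p).2 x = c • ∫ x, φ x • p.2 x := by
      rw [← integral_smul]
      refine integral_congr_ae ?_
      filter_upwards [Lp.coeFn_smul c p.2] with x hx
      simp [hx, smul_comm c (φ x)]
    rw [e1, e2, hp φ hφ hc, smul_neg]

/-- Weak derivatives are unique. -/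
theorem weakDerivGraph_unique (p : Hil × Hil) (hp : p ∈ weakDerivGraph) (h : p.1 = 0) :
    p.2 = 0 := by
  rw [Lp.eq_zero_iff_ae_eq_zero]
  refine ae_eq_zero_of_integral_contDiff_smul_eq_zero (Hil.locallyIntegrable p.2) ?_
  intro φ hφ hc
  have h1 := hp φ hφ hc
  have h2 : ∫ x, deriv φ x • p.1 x = 0 := by
    rw [h, integral_congr_ae (g := fun _ => (0 : C2))]
    · simp
    · exact Filter.Eventually.of_forall fun x => by simp
  rw [h2] at h1
  simpa using h1.symm

/-- The weak derivative `d/dx` as an operator in `L²(ℝ; ℂ²)`; its domain is the Sobolev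
space `H¹(ℝ; ℂ²)`. -/
def weakDeriv : Hil →ₗ.[ℂ] Hil := weakDerivGraph.toLinearPMap

theorem weakDeriv_graph : weakDeriv.graph = weakDerivGraph :=
  Submodule.toLinearPMap_graph_eq _ weakDerivGraph_unique

/-- Pointwise application of a constant matrix, as a bounded operator on `L²(ℝ; ℂ²)`. -/
def constMat (M : Matrix (Fin 2) (Fin 2) ℂ) : Hil →L[ℂ] Hil :=
  (matOp M).compLpL 2 (volume : Measure ℝ)

/-- The free Dirac operator `H₀ = -i d/dx σ₁ + m σ₃` with domain `H¹(ℝ; ℂ²)`. -/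
def freeDirac (m : ℝ) : Hil →ₗ.[ℂ] Hil where
  domain := weakDeriv.domain
  toFun := (constMat ((-Complex.I) • sigma1) : Hil →ₗ[ℂ] Hil) ∘ₗ weakDeriv.toFun +
    (constMat ((m : ℂ) • sigma3) : Hil →ₗ[ℂ] Hil) ∘ₗ weakDeriv.domain.subtype

/-! ### Potentials -/

/-- `q ∈ L¹(ℝ) + L^∞_0(ℝ)`: a sum of an integrable function and a bounded function that vanishes
at infinity. -/
def MemL1AddLinfZero (q : ℝ → ℂ) : Prop :=
  ∃ w x : ℝ → ℂ, Integrable w volume ∧ MemLp x ∞ volume ∧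
    (∀ δ : ℝ, 0 < δ → ∃ r : ℝ, ∀ᵐ t : ℝ, r ≤ |t| → ‖x t‖ ≤ δ) ∧
    ∀ᵐ t : ℝ, q t = w t + x t

/-- `C_ε`: the infimum of `∫ ‖W(x)‖ dx` over all decompositions `V = W + X` with `W` integrable and
`X` measurable with `‖X(x)‖ ≤ ε` almost everywhere. -/
def splitCost (V : ℝ → Matrix (Fin 2) (Fin 2) ℂ) (ε : ℝ) : ℝ :=
  sInf {c : ℝ | ∃ W X : ℝ → Matrix (Fin 2) (Fin 2) ℂ,
    (∀ᵐ t : ℝ, V t = W t + X t) ∧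
    (∀ i j, Integrable (fun t => W t i j) volume) ∧
    (∀ i j, AEStronglyMeasurable (fun t => X t i j) volume) ∧
    (∀ᵐ t : ℝ, ‖matOp (X t)‖ ≤ ε) ∧
    c = ∫ t, ‖matOp (W t)‖}

/-- The maximal operator of multiplication by a matrix-valued function `M`, with domain
`{f ∈ L² : M f ∈ L²}`. -/
def mulOp (M : ℝ → Matrix (Fin 2) (Fin 2) ℂ) : Hil →ₗ.[ℂ] Hil where
  domain :=
    { carrier := {f | MemLp (fun t => matOp (M t) (f t)) 2 volume}
      zero_mem' := by
        refine MemLp.ae_eq ?_ (MemLp.zero (p := 2) (μ := (volume : Measure ℝ)) (ε := C2))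
        exact Filter.Eventually.of_forall fun t => by simp
      add_mem' := by
        intro f g hf hg
        refine MemLp.ae_eq ?_ (hf.add hg)
        filter_upwards [Lp.coeFn_add f g] with t ht
        simp only [ht, Pi.add_apply, map_add]
      smul_mem' := by
        intro c f hf
        refine MemLp.ae_eq ?_ (hf.const_smul c)
        filter_upwards [Lp.coeFn_smul c f] with t ht
        simp only [ht, Pi.smul_apply, map_smul] }
  toFun :=
    { toFun := fun f => MemLp.toLp _ f.2
      map_add' := by
        intro f g
        rw [← MemLp.toLp_add, MemLp.toLp_eq_toLp_iff]
        filter_upwards [Lp.coeFn_add (f : Hil) (g : Hil)] with t ht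
        simp only [Submodule.coe_add, ht, Pi.add_apply, map_add]
      map_smul' := by
        intro c f
        rw [RingHom.id_apply, ← MemLp.toLp_const_smul, MemLp.toLp_eq_toLp_iff]
        filter_upwards [Lp.coeFn_smul c (f : Hil)] with t ht
        simp only [Submodule.coe_smul, ht, Pi.smul_apply, map_smul] }

/-- The modulus `|M| = (M* M)^{1/2}` of a matrix. -/
def matAbs (M : Matrix (Fin 2) (Fin 2) ℂ) : Matrix (Fin 2) (Fin 2) ℂ :=
  cfc Real.sqrt (Mᴴ * M)

/-- The square root `|M|^{1/2}`. -/
def matAbsSqrt (M : Matrix (Fin 2) (Fin 2) ℂ) : Matrix (Fin 2) (Fin 2) ℂ :=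
  cfc Real.sqrt (matAbs M)

/-- The partial isometry `U` in the polar decomposition `M = U |M|`: it is `M |M|⁻¹` on the range
of `|M|` and `0` on the kernel of `|M|` (recall that `0⁻¹ = 0` in `ℝ`). -/
def matPolar (M : Matrix (Fin 2) (Fin 2) ℂ) : Matrix (Fin 2) (Fin 2) ℂ :=
  M * cfc (fun s : ℝ => s⁻¹) (matAbs M)

theorem conjTranspose_mul_self_isSelfAdjoint (M : Matrix (Fin 2) (Fin 2) ℂ) :
    IsSelfAdjoint (Mᴴ * M) :=
  Matrix.isHermitian_conjTranspose_mul_self M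

theorem continuousOn_spectrum {N : Matrix (Fin 2) (Fin 2) ℂ} (f : ℝ → ℝ) :
    ContinuousOn f (_root_.spectrum ℝ N) :=
  Matrix.finite_real_spectrum.continuousOn f

open scoped ComplexOrder in
theorem spectrum_conjTranspose_mul_self_nonneg (M : Matrix (Fin 2) (Fin 2) ℂ) :
    ∀ s ∈ _root_.spectrum ℝ (Mᴴ * M), 0 ≤ s := by
  intro s hs
  have h := (Matrix.posSemidef_iff_isHermitian_and_spectrum_nonneg.mp
    (Matrix.posSemidef_conjTranspose_mul_self M)).2 (spectrum.algebraMap_mem ℂ hs)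
  have h' : (0 : ℂ) ≤ (s : ℂ) := h
  exact_mod_cast h'

theorem matAbs_mul_self (M : Matrix (Fin 2) (Fin 2) ℂ) : matAbs M * matAbs M = Mᴴ * M := by
  rw [matAbs, ← cfc_mul _ _ _ (continuousOn_spectrum _) (continuousOn_spectrum _)]
  conv_rhs => rw [← cfc_id' ℝ (Mᴴ * M) (conjTranspose_mul_self_isSelfAdjoint M)]
  exact cfc_congr fun s hs =>
    Real.mul_self_sqrt (spectrum_conjTranspose_mul_self_nonneg M s hs)

theorem matAbs_isSelfAdjoint (M : Matrix (Fin 2) (Fin 2) ℂ) : IsSelfAdjoint (matAbs M) :=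
  cfc_predicate _ _

theorem spectrum_matAbs_nonneg (M : Matrix (Fin 2) (Fin 2) ℂ) :
    ∀ s ∈ _root_.spectrum ℝ (matAbs M), 0 ≤ s := by
  intro s hs
  rw [matAbs, cfc_map_spectrum (R := ℝ) Real.sqrt (Mᴴ * M)
    (conjTranspose_mul_self_isSelfAdjoint M) (continuousOn_spectrum _)] at hs
  obtain ⟨t, -, rfl⟩ := hs
  exact Real.sqrt_nonneg t

theorem matAbsSqrt_mul_self (M : Matrix (Fin 2) (Fin 2) ℂ) :
    matAbsSqrt M * matAbsSqrt M = matAbs M := by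
  rw [matAbsSqrt, ← cfc_mul _ _ _ (continuousOn_spectrum _) (continuousOn_spectrum _)]
  conv_rhs => rw [← cfc_id' ℝ (matAbs M) (matAbs_isSelfAdjoint M)]
  exact cfc_congr fun s hs => Real.mul_self_sqrt (spectrum_matAbs_nonneg M s hs)

open scoped ComplexOrder in
/-- The polar decomposition `M = U |M|`. -/
theorem matPolar_mul_matAbs (M : Matrix (Fin 2) (Fin 2) ℂ) : matPolar M * matAbs M = M := by
  set P : Matrix (Fin 2) (Fin 2) ℂ := cfc (fun s : ℝ => s⁻¹) (matAbs M) * matAbs M with hP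
  have hAP : matAbs M * P = matAbs M := by
    have e : matAbs M = cfc (fun s : ℝ => s) (matAbs M) :=
      (cfc_id' ℝ (matAbs M) (matAbs_isSelfAdjoint M)).symm
    have : cfc (fun s : ℝ => s) (matAbs M) *
        (cfc (fun s : ℝ => s⁻¹) (matAbs M) * cfc (fun s : ℝ => s) (matAbs M))
        = cfc (fun s : ℝ => s) (matAbs M) := by
      rw [← cfc_mul _ _ _ (continuousOn_spectrum _) (continuousOn_spectrum _),
        ← cfc_mul _ _ _ (continuousOn_spectrum _) (continuousOn_spectrum _)]
      refine cfc_congr fun s _ => ?_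
      by_cases h : s = 0
      · simp [h]
      · field_simp
    rw [← e] at this
    exact this
  have h0 : (M * P - M)ᴴ * (M * P - M) = 0 := by
    have : (M * P - M)ᴴ * (M * P - M) = (P - 1)ᴴ * (matAbs M * (matAbs M * (P - 1))) := by
      rw [← mul_assoc (matAbs M), matAbs_mul_self,
        show M * P - M = M * (P - 1) by rw [mul_sub, mul_one], Matrix.conjTranspose_mul]
      simp only [mul_assoc]
    rw [this, mul_sub, hAP, mul_one, sub_self, mul_zero, mul_zero]
  rw [Matrix.conjTranspose_mul_self_eq_zero, sub_eq_zero] at h0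
  rw [matPolar, mul_assoc]
  exact h0

/-- The factorization `M = (U |M|^{1/2}) |M|^{1/2}`. -/
theorem factorization (M : Matrix (Fin 2) (Fin 2) ℂ) :
    matPolar M * matAbsSqrt M * matAbsSqrt M = M := by
  rw [mul_assoc, matAbsSqrt_mul_self, matPolar_mul_matAbs]

/-- The Dirac operator `H = H₀ + V`: the closed extension of `H₀ + V` attached to the factorization
`V = B A` with `A = |V|^{1/2}`, `B = U |V|^{1/2}`, where `V = U |V|` is the pointwise polar
decomposition and `A`, `B` are maximal multiplication operators. -/
def diracOp (m : ℝ) (V : ℝ → Matrix (Fin 2) (Fin 2) ℂ) : Hil →ₗ.[ℂ] Hil :=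
  factorizedPerturbation (freeDirac m) (mulOp fun t => matAbsSqrt (V t))
    (mulOp fun t => matPolar (V t) * matAbsSqrt (V t))

/-! ### Scalar functions of the spectral parameter -/

/-- The square root on `ℂ \ [0, ∞)` with positive imaginary part. -/
def upperSqrt (w : ℂ) : ℂ := Complex.I * Complex.sqrt (-w)

theorem upperSqrt_sq (w : ℂ) : upperSqrt w ^ 2 = w := by
  have h : Complex.sqrt (-w) ^ 2 = -w := by
    rw [Complex.sqrt, ← Complex.cpow_nat_mul]
    simp
  rw [upperSqrt, mul_pow, h, Complex.I_sq]
  ring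

theorem upperSqrt_im_pos {w : ℂ} (hw : ¬(0 ≤ w.re ∧ w.im = 0)) : 0 < (upperSqrt w).im := by
  have h : (Complex.sqrt (-w)).re = √((‖-w‖ + (-w).re) / 2) := Complex.cpow_inv_two_re _
  have h2 : (upperSqrt w).im = (Complex.sqrt (-w)).re := by simp [upperSqrt]
  rw [h2, h, norm_neg, Complex.neg_re]
  refine Real.sqrt_pos.mpr ?_
  have h3 : w.re < ‖w‖ := by
    refine lt_of_le_of_ne (Complex.re_le_norm w) fun he => hw ?_
    have := Complex.re_eq_norm.mp he
    exact ⟨(Complex.le_def.mp this).1, (Complex.le_def.mp this).2.symm⟩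
  linarith

/-- `Φ(z) = (z + m) / (z - m)`. -/
def Phi (m : ℝ) (z : ℂ) : ℂ := (z + m) / (z - m)

/-- `η(s) = (1/2 + (s + s⁻¹)/4)^{1/2}`. -/
def eta (s : ℝ) : ℝ := Real.sqrt (1 / 2 + 1 / 4 * (s + s⁻¹))

end

end DiracSpec

/-! Let k = √(z² − m²) with Im k > 0 and ζ = (z + m)/k, so that ζ² = Φ(z). The free resolvent is
convolution with F(t) = (i/2) e^{ik|t|} (diag(ζ, ζ⁻¹) + sgn(t) σ₁). The Hilbert–Schmidt norm of its
matrix factor is at most η = η(|Φ(z)|), hence ‖F(t)‖ ≤ η e^{−(Im k)|t|}. Therefore R₀(z) has norm at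
most η from L¹ to L^∞, and at most β = η/√(Im k) from L¹ to L² and from L² to L^∞. On L² its norm is
at most d = 1/dist(z, σ(H₀)), because R₀(z) is normal.

Split V = W + X with ∫‖W‖ = c and ‖X‖ ≤ ε. If ‖f‖_∞ ≤ s and ‖f‖₂ ≤ τ, then Vf is an L¹ function of
norm at most cs plus an L² function of norm at most ετ. So R₀(z)Vf has the bounds ηcs + βετ in L^∞
and βcs + dετ in L². The pair (s, τ) is thus transformed by a nonnegative 2 × 2 matrix, and the
conditions ηc < 1 and d + β²c/(1 − ηc) < 1/ε say that its spectral radius is less than 1.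
Concretely, some weighted sum ps + τ contracts by a factor θ < 1 (`exists_contraction_weights`).
These conditions are open in c, so c may be taken close to C_ε even if the infimum is not attained.

Since Q^{n+1} = A (R₀V)ⁿ cl(R₀B), the powers of Q decay geometrically (`closureARB_pow_apply`), so I
+ Q is invertible (`isUnit_one_add_of_norm_pow_le`) and the resolvent formula makes sense at z. It
remains to pass from the point at which H was defined to z: the operators given by the formula
satisfy the first resolvent identity (`IsPerturbedResolvent.sub_apply`), and the one at z is
injective, which makes it the resolvent of H at z (`IsPerturbedResolvent.mem_resolventSet`). -/

namespace DiracSpec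

noncomputable section

/-! ### Resolvent identities and the resolvent of a factorized perturbation. -/

section AbstractResolvents

variable {E K : Type*} [NormedAddCommGroup E] [NormedSpace ℂ E]
  [NormedAddCommGroup K] [NormedSpace ℂ K]

theorem mem_resolventSet_iff_not_mem_spectrum {T : E →ₗ.[ℂ] E} {z : ℂ} :
    z ∈ resolventSet T ↔ z ∉ spectrum T := by
  simp [spectrum]

theorem IsResolventAt.injective {T : E →ₗ.[ℂ] E} {z : ℂ} {R : E →L[ℂ] E}
    (h : IsResolventAt T z R) {f : E} (hf : R f = 0) : f = 0 := by
  obtain ⟨hd, hg⟩ := h.1 f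
  have h0 : (⟨R f, hd⟩ : T.domain) = 0 := by ext; simpa using hf
  rw [h0, hf] at hg
  simpa using hg.symm

/-- First resolvent identity: apply R to (T − z) S f = f + (w − z) S f. -/
theorem IsResolventAt.sub_apply {T : E →ₗ.[ℂ] E} {z w : ℂ} {R S : E →L[ℂ] E}
    (hR : IsResolventAt T z R) (hS : IsResolventAt T w S) (f : E) :
    R f - S f = (z - w) • R (S f) := by
  obtain ⟨hd, hg⟩ := hS.1 f
  have h2 := hR.2 ⟨S f, hd⟩
  have h3 : T ⟨S f, hd⟩ = f + w • S f := sub_eq_iff_eq_add.1 hg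
  simp only [h3, map_sub, map_add, map_smul] at h2
  rw [sub_smul, sub_eq_iff_eq_add]
  nth_rewrite 3 [← h2]
  abel

/-- Exchange the two points in the resolvent identity and compare; the case z = w, where z − w
cannot be cancelled, is uniqueness of the resolvent. -/
theorem IsResolventAt.commute {T : E →ₗ.[ℂ] E} {z w : ℂ} {R S : E →L[ℂ] E}
    (hR : IsResolventAt T z R) (hS : IsResolventAt T w S) : R * S = S * R := by
  by_cases hzw : z = w
  · subst hzw
    rw [hR.unique hS]
  · ext f
    have h1 := hR.sub_apply hS f
    have h2 := hS.sub_apply hR f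
    have h3 : (z - w) • (R (S f) - S (R f)) = 0 := by
      rw [smul_sub, ← h1, ← neg_sub w z, neg_smul, ← h2]
      abel
    rcases smul_eq_zero.1 h3 with h | h
    · exact absurd (sub_eq_zero.1 h) hzw
    · exact sub_eq_zero.1 h

/-- If `1 - (w - z) R(z)` has the bounded inverse `S`, then `w ∈ ρ(T)`. -/
theorem IsResolventAt.mem_resolventSet_of_isUnit {T : E →ₗ.[ℂ] E} {z w : ℂ} {R : E →L[ℂ] E}
    (hR : IsResolventAt T z R) (hu : IsUnit (1 - (w - z) • R)) : w ∈ resolventSet T := by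
  obtain ⟨u, hu⟩ := hu
  have h1 : ∀ f, (u⁻¹ : (E →L[ℂ] E)ˣ).1 (f - (w - z) • R f) = f := by
    intro f
    have := congrArg (fun L : E →L[ℂ] E => L f) u.inv_mul
    simp only [hu] at this
    simpa using this
  have h2 : ∀ f, (u⁻¹ : (E →L[ℂ] E)ˣ).1 f - (w - z) • R ((u⁻¹ : (E →L[ℂ] E)ˣ).1 f) = f := by
    intro f
    have := congrArg (fun L : E →L[ℂ] E => L f) u.mul_inv
    simp only [hu] at this
    simpa using this
  refine ⟨R * (u⁻¹ : (E →L[ℂ] E)ˣ).1, ?_, ?_⟩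
  · intro g
    obtain ⟨hd, hg⟩ := hR.1 ((u⁻¹ : (E →L[ℂ] E)ˣ).1 g)
    refine ⟨hd, ?_⟩
    have h3 := h2 g
    change T ⟨R ((u⁻¹ : (E →L[ℂ] E)ˣ).1 g), hd⟩ - w • R ((u⁻¹ : (E →L[ℂ] E)ˣ).1 g) = g
    rw [sub_eq_iff_eq_add.1 hg]
    refine Eq.trans ?_ h3
    rw [sub_smul]
    abel
  · intro f
    have h3 := hR.2 f
    have hc : R * (u⁻¹ : (E →L[ℂ] E)ˣ).1 = (u⁻¹ : (E →L[ℂ] E)ˣ).1 * R := by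
      have : Commute R u.1 := by
        rw [hu]
        exact (Commute.one_right R).sub_right ((Commute.refl R).smul_right _)
      exact this.units_inv_right
    rw [hc]
    change (u⁻¹ : (E →L[ℂ] E)ˣ).1 (R (T f - w • (f : E))) = f
    have h4 : R (T f - w • (f : E)) = (f : E) - (w - z) • R f := by
      nth_rewrite 2 [← h3]
      simp only [map_sub, map_smul, sub_smul]
      abel
    rw [h4, h1]

/-- By the Neumann series the disc of radius 1/(‖R‖ + 1) about z misses the spectrum. Nonemptiness
is needed because `Metric.infDist` to the empty set is 0. -/
theorem IsResolventAt.infDist_pos [CompleteSpace E] {T : E →ₗ.[ℂ] E} {z : ℂ} {R : E →L[ℂ] E}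
    (hR : IsResolventAt T z R) (hne : (spectrum T).Nonempty) :
    0 < Metric.infDist z (spectrum T) := by
  have hpos : 0 < (‖R‖ + 1)⁻¹ := by positivity
  refine lt_of_lt_of_le hpos ((Metric.le_infDist hne).2 fun w hw => ?_)
  by_contra! hlt
  refine hw (hR.mem_resolventSet_of_isUnit (isUnit_one_sub_of_norm_lt_one ?_))
  rw [dist_comm, dist_eq_norm] at hlt
  calc ‖(w - z) • R‖ ≤ ‖w - z‖ * (‖R‖ + 1) := by
        rw [norm_smul]; gcongr; linarith
    _ < (‖R‖ + 1)⁻¹ * (‖R‖ + 1) := by gcongr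
    _ = 1 := inv_mul_cancel₀ (by positivity)

/-- The resolvent formula for factorized perturbations satisfies the first resolvent identity. -/
theorem IsPerturbedResolvent.sub_apply {H₀ : E →ₗ.[ℂ] E} {A : E →ₗ.[ℂ] K} {B : K →ₗ.[ℂ] E}
    (hB : Dense (B.domain : Set K)) {z w : ℂ} {R S : E →L[ℂ] E}
    (hR : IsPerturbedResolvent H₀ A B z R) (hS : IsPerturbedResolvent H₀ A B w S) (f : E) :
    R f - S f = (z - w) • R (S f) := by
  obtain ⟨hz, AR, RB, Q, hAR, hRB, hQ, hu, rfl⟩ := hR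
  obtain ⟨hw, AR', RB', Q', hAR', hRB', hQ', hu', rfl⟩ := hS
  have hz' := isResolventAt_resolvent hz
  have hw' := isResolventAt_resolvent hw
  set R₁ := resolvent H₀ z
  set R₂ := resolvent H₀ w
  have i0 : ∀ f, R₁ f = R₂ f + (z - w) • R₁ (R₂ f) := fun f => by
    rw [← hz'.sub_apply hw' f]; abel
  have i1 : ∀ f, AR f = AR' f + (z - w) • AR (R₂ f) := fun f => by
    obtain ⟨h1, e1⟩ := hAR f
    obtain ⟨h2, e2⟩ := hAR' f
    obtain ⟨h3, e3⟩ := hAR (R₂ f)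
    rw [← e1, ← e2, ← e3, ← LinearPMap.map_smul, ← LinearPMap.map_add]
    congr 1
    exact Subtype.ext (i0 f)
  -- On dom B this is the free resolvent identity applied to B g; density of dom B and continuity
  -- give it everywhere. The same argument proves `i3`.
  have i2 : ∀ g, RB g = RB' g + (z - w) • R₁ (RB' g) := fun g => by
    refine congrFun (RB.continuous.ext_on hB
      (RB'.continuous.add ((R₁.continuous.comp RB'.continuous).const_smul _)) ?_) g
    intro g hg
    have e1 := hRB ⟨g, hg⟩
    have e2 := hRB' ⟨g, hg⟩
    simp only at e1 e2
    change RB g = RB' g + (z - w) • R₁ (RB' g)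
    rw [← e1, ← e2, i0]
  have i3 : ∀ g, Q g = Q' g + (z - w) • AR (RB' g) := fun g => by
    refine congrFun (Q.continuous.ext_on hB
      (Q'.continuous.add ((AR.continuous.comp RB'.continuous).const_smul _)) ?_) g
    intro g hg
    have e1 := hRB' ⟨g, hg⟩
    obtain ⟨d2, e2⟩ := hQ ⟨g, hg⟩
    obtain ⟨d3, e3⟩ := hQ' ⟨g, hg⟩
    obtain ⟨d4, e4⟩ := hAR (R₂ (B ⟨g, hg⟩))
    simp only at e1 e2 e3 e4
    change Q g = Q' g + (z - w) • AR (RB' g)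
    rw [← e1, ← e2, ← e3, ← e4, ← LinearPMap.map_smul, ← LinearPMap.map_add]
    congr 1
    exact Subtype.ext (i0 _)
  have m1 : ∀ g, Ring.inverse (1 + Q) (g + Q g) = g := fun g => by
    have := congrArg (fun L : K →L[ℂ] K => L g) (Ring.inverse_mul_cancel _ hu)
    simpa using this
  have m2 : ∀ g, Ring.inverse (1 + Q') g + Q' (Ring.inverse (1 + Q') g) = g := fun g => by
    have := congrArg (fun L : K →L[ℂ] K => L g) (Ring.mul_inverse_cancel _ hu')
    simpa using this
  set M := Ring.inverse (1 + Q)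
  set M' := Ring.inverse (1 + Q')
  simp only [_root_.sub_apply, ContinuousLinearMap.comp_apply, map_sub, smul_sub]
  set g := M' (AR' f) with hg
  have k1 : (z - w) • R₁ (R₂ f) = R₁ f - R₂ f := (hz'.sub_apply hw' f).symm
  have k2 : (z - w) • R₁ (RB' g) = RB g - RB' g := by rw [i2 g]; abel
  have k3 : (z - w) • RB (M (AR (R₂ f))) = RB (M (AR f)) - RB (M (AR' f)) := by
    rw [← map_sub, ← map_sub, i1 f, add_sub_cancel_left, map_smul, map_smul]
  -- The key cancellation: by `i3` the factor between the two inverses is (z − w) AR RB' = (1 + Q) −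
  -- (1 + Q'), so the product telescopes.
  have k4 : (z - w) • RB (M (AR (RB' g))) = RB g - RB (M (AR' f)) := by
    have e : (z - w) • AR (RB' g) = (g + Q g) - AR' f := by
      rw [← m2 (AR' f), ← hg, i3 g]; abel
    rw [← map_smul, ← map_smul, e, map_sub, m1, map_sub]
  rw [k1, k2, k3, k4]
  abel

/-- `z ∈ ρ(H)` as soon as the resolvent formula makes sense at `z` and `cl(R₀(z) B)` maps into the
domain of `A`. -/
theorem IsPerturbedResolvent.mem_resolventSet {H₀ : E →ₗ.[ℂ] E} {A : E →ₗ.[ℂ] K} {B : K →ₗ.[ℂ] E}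
    (hB : Dense (B.domain : Set K)) {z : ℂ} {R : E →L[ℂ] E}
    (hR : IsPerturbedResolvent H₀ A B z R) (hinj : ∀ f, R f = 0 → f = 0) :
    z ∈ resolventSet (factorizedPerturbation H₀ A B) := by
  have hex : ∃ p : ℂ × (E →L[ℂ] E), IsPerturbedResolvent H₀ A B p.1 p.2 := ⟨(z, R), hR⟩
  rw [factorizedPerturbation, dif_pos hex]
  have hS := hex.choose_spec
  set w := hex.choose.1
  set S := hex.choose.2
  have i1 := fun f => hR.sub_apply hB hS f
  have i2 := fun f => hS.sub_apply hB hR f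
  -- The base point w of the definition is arbitrary, so injectivity of S is not given; the
  -- resolvent identity shows that S f = 0 forces R f = 0.
  have hker : LinearMap.ker ((S : E →ₗ[ℂ] E).toPMap ⊤).toFun = ⊥ := by
    rw [LinearMap.ker_eq_bot']
    rintro ⟨f, hf⟩ h
    have h0 : S f = 0 := h
    have h1 := i1 f
    rw [h0, map_zero, smul_zero, sub_zero] at h1
    exact Subtype.ext (hinj f h1)
  have hdom : ∀ f, S f ∈ ((S : E →ₗ[ℂ] E).toPMap ⊤).inverse.domain := fun f => by
    rw [LinearPMap.inverse_domain]
    exact ⟨⟨f, trivial⟩, rfl⟩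
  have happ : ∀ f h, (w • (LinearMap.id : E →ₗ[ℂ] E) +ᵥ
      ((S : E →ₗ[ℂ] E).toPMap ⊤).inverse) ⟨S f, h⟩ = w • S f + f := fun f h => by
    rw [LinearPMap.vadd_apply]
    congr 1
    exact LinearPMap.inverse_apply_eq hker (x := ⟨f, trivial⟩) rfl
  refine ⟨R, fun g => ?_, ?_⟩
  -- The identity puts the range of R inside that of S, which is the domain of H.
  · have e : R g = S (g + (z - w) • R g) := by
      rw [map_add, map_smul, ← neg_sub w z, neg_smul, ← i2 g]; abel
    have hd : R g ∈ (w • (LinearMap.id : E →ₗ[ℂ] E) +ᵥ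
        ((S : E →ₗ[ℂ] E).toPMap ⊤).inverse).domain := by
      rw [e]; exact hdom _
    refine ⟨hd, ?_⟩
    have h1 : (⟨R g, hd⟩ : (w • (LinearMap.id : E →ₗ[ℂ] E) +ᵥ
        ((S : E →ₗ[ℂ] E).toPMap ⊤).inverse).domain) =
        ⟨S (g + (z - w) • R g), hdom _⟩ := Subtype.ext e
    rw [h1, happ, ← e, sub_smul]
    abel
  · rintro ⟨f, hf⟩
    have hf2 : f ∈ LinearMap.range ((S : E →ₗ[ℂ] E).toPMap ⊤).toFun := by
      rw [← LinearPMap.inverse_domain]; exact hf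
    obtain ⟨g, hg⟩ := hf2
    have hg' : S g = f := hg
    subst hg'
    rw [happ]
    have e : w • S g + g - z • S g = g - (z - w) • S g := by rw [sub_smul]; abel
    simp only [e, map_sub, map_smul]
    rw [← i1 g]
    abel

end AbstractResolvents

/-! ### Norm of a normal resolvent. -/

section NormalResolvent

variable {E : Type*} [NormedAddCommGroup E] [InnerProductSpace ℂ E] [CompleteSpace E]

/-- The resolvent bound `‖(T - z)⁻¹‖ ≤ 1 / dist(z, σ(T))` when the resolvent is normal. -/
theorem IsResolventAt.norm_le_of_isStarNormal {T : E →ₗ.[ℂ] E} {z : ℂ} {R : E →L[ℂ] E}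
    (hR : IsResolventAt T z R) (hN : IsStarNormal R) (hne : (spectrum T).Nonempty) :
    ‖R‖ ≤ 1 / Metric.infDist z (spectrum T) := by
  have hpos := hR.infDist_pos hne
  rcases subsingleton_or_nontrivial E with hE | hE
  · have : R = 0 := Subsingleton.elim _ _
    rw [this, norm_zero]
    positivity
  have : Nontrivial (E →L[ℂ] E) := inferInstance
  -- A normal operator has norm equal to its spectral radius, which is attained at some l ∈ σ(R).
  obtain ⟨l, hl, hl2⟩ := spectrum.exists_nnnorm_eq_spectralRadius R
  rw [hN.spectralRadius_eq_nnnorm] at hl2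
  have hl3 : ‖l‖ = ‖R‖ := by
    have : ‖l‖₊ = ‖R‖₊ := by exact_mod_cast hl2
    exact congrArg NNReal.toReal this
  by_cases h0 : l = 0
  · rw [← hl3, h0, norm_zero]
    positivity
  -- Spectral mapping: if S were the resolvent of T at z + 1/l, then l⁻¹(1 + l⁻¹ S) would invert l −
  -- R. Hence dist(z, σ(T)) ≤ 1/|l| = 1/‖R‖.
  have hw : z + l⁻¹ ∈ spectrum T := by
    intro hw
    obtain ⟨S, hS⟩ := hw
    refine hl ?_
    have h1 : R - S = -(l⁻¹ • (R * S)) := by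
      ext f
      simpa using hR.sub_apply hS f
    have h2 : R - S = -(l⁻¹ • (S * R)) := by rw [h1, hR.commute hS]
    refine ⟨⟨algebraMap ℂ _ l - R, l⁻¹ • (1 + l⁻¹ • S), ?_, ?_⟩, rfl⟩
    · rw [Algebra.algebraMap_eq_smul_one, mul_smul_comm, mul_add, mul_one, mul_smul_comm, sub_mul,
        smul_mul_assoc, one_mul, smul_sub, smul_smul, inv_mul_cancel₀ h0, one_smul,
        show l • (1 : E →L[ℂ] E) - R + (S - l⁻¹ • (R * S)) = l • 1 - (R - S) - l⁻¹ • (R * S) by abel,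
        h1, sub_neg_eq_add, add_sub_cancel_right, smul_smul, inv_mul_cancel₀ h0, one_smul]
    · rw [Algebra.algebraMap_eq_smul_one, smul_mul_assoc, add_mul, one_mul, smul_mul_assoc, mul_sub,
        mul_smul_comm, mul_one, smul_sub, smul_smul, inv_mul_cancel₀ h0, one_smul,
        show l • (1 : E →L[ℂ] E) - R + (S - l⁻¹ • (S * R)) = l • 1 - (R - S) - l⁻¹ • (S * R) by abel,
        h2, sub_neg_eq_add, add_sub_cancel_right, smul_smul, inv_mul_cancel₀ h0, one_smul]
  have h5 := Metric.infDist_le_dist_of_mem (x := z) hw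
  rw [dist_eq_norm, sub_add_cancel_left, norm_neg, norm_inv, hl3] at h5
  rw [le_div_iff₀ hpos]
  calc ‖R‖ * Metric.infDist z (spectrum T) ≤ ‖R‖ * ‖R‖⁻¹ := by gcongr
    _ ≤ 1 := mul_inv_le_one

end NormalResolvent

/-! ### Norms and measurability of the polar factors of 2 × 2 matrices. -/

section MatrixLemmas

abbrev Mat2 : Type := Matrix (Fin 2) (Fin 2) ℂ

theorem matOp_mul (M N : Mat2) : matOp (M * N) = matOp M ∘L matOp N :=
  map_mul (Matrix.toEuclideanCLM (n := Fin 2) (𝕜 := ℂ)) M N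

theorem matOp_mul_apply (M N : Mat2) (v : C2) : matOp (M * N) v = matOp M (matOp N v) := by
  rw [matOp_mul]; rfl

theorem matOp_add (M N : Mat2) : matOp (M + N) = matOp M + matOp N :=
  map_add (Matrix.toEuclideanCLM (n := Fin 2) (𝕜 := ℂ)) M N

theorem matOp_smul (c : ℂ) (M : Mat2) : matOp (c • M) = c • matOp M :=
  map_smul (Matrix.toEuclideanCLM (n := Fin 2) (𝕜 := ℂ)) c M

theorem matOp_one : matOp 1 = 1 :=
  map_one (Matrix.toEuclideanCLM (n := Fin 2) (𝕜 := ℂ))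

theorem matOp_conjTranspose (M : Mat2) : matOp Mᴴ = star (matOp M) :=
  map_star (Matrix.toEuclideanCLM (n := Fin 2) (𝕜 := ℂ)) M

theorem matOp_apply (M : Mat2) (v : C2) (i : Fin 2) :
    matOp M v i = M i 0 * v 0 + M i 1 * v 1 := by
  rw [matOp, Matrix.ofLp_toEuclideanCLM]
  simp [Matrix.mulVec, dotProduct, Fin.sum_univ_two]

theorem norm_matOp_sq (M : Mat2) : ‖matOp M‖ ^ 2 = ‖matOp (Mᴴ * M)‖ := by
  have : matOp (Mᴴ * M) = star (matOp M) * matOp M := by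
    rw [matOp_mul, matOp_conjTranspose]; rfl
  rw [this, sq]
  exact CStarRing.norm_star_mul_self.symm

theorem norm_matOp_matAbs (M : Mat2) : ‖matOp (matAbs M)‖ = ‖matOp M‖ := by
  have h : (matAbs M)ᴴ = matAbs M := matAbs_isSelfAdjoint M
  rw [← sq_eq_sq₀ (norm_nonneg _) (norm_nonneg _), norm_matOp_sq, norm_matOp_sq, h, matAbs_mul_self]

theorem norm_matOp_matAbsSqrt_sq (M : Mat2) : ‖matOp (matAbsSqrt M)‖ ^ 2 = ‖matOp M‖ := by
  have h : (matAbsSqrt M)ᴴ = matAbsSqrt M := cfc_predicate (p := IsSelfAdjoint) _ _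
  rw [norm_matOp_sq, h, matAbsSqrt_mul_self, norm_matOp_matAbs]

/-- Writing U|M|^{1/2} as M times a function of |M| makes its Gram matrix a function of |M| alone.
-/
theorem matPolar_mul_matAbsSqrt (M : Mat2) :
    matPolar M * matAbsSqrt M = M * cfc (fun s : ℝ => s⁻¹ * √s) (matAbs M) := by
  rw [matPolar, mul_assoc, matAbsSqrt, ← cfc_mul _ _ _ (continuousOn_spectrum _)
    (continuousOn_spectrum _)]

/-- The Gram matrix of U|M|^{1/2} is |M|, so both factors A and B have pointwise norm ‖V‖^{1/2}. -/
theorem norm_matOp_matPolar_mul_sq (M : Mat2) :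
    ‖matOp (matPolar M * matAbsSqrt M)‖ ^ 2 = ‖matOp M‖ := by
  set C := cfc (fun s : ℝ => s⁻¹ * √s) (matAbs M) with hC
  have hCs : Cᴴ = C := cfc_predicate (p := IsSelfAdjoint) _ _
  have e : matAbs M = cfc (fun s : ℝ => s) (matAbs M) :=
      (cfc_id' ℝ (matAbs M) (matAbs_isSelfAdjoint M)).symm
  have h : (M * C)ᴴ * (M * C) = matAbs M := by
    rw [Matrix.conjTranspose_mul, hCs, mul_assoc, ← mul_assoc Mᴴ, ← matAbs_mul_self]
    have h2 : C * (cfc (fun s : ℝ => s) (matAbs M) * cfc (fun s : ℝ => s) (matAbs M) * C) =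
        cfc (fun s : ℝ => s) (matAbs M) := by
      rw [hC, ← cfc_mul _ _ _ (continuousOn_spectrum _) (continuousOn_spectrum _),
        ← cfc_mul _ _ _ (continuousOn_spectrum _) (continuousOn_spectrum _),
        ← cfc_mul _ _ _ (continuousOn_spectrum _) (continuousOn_spectrum _)]
      refine cfc_congr fun s hs => ?_
      have h0 := Real.mul_self_sqrt (spectrum_matAbs_nonneg M s hs)
      by_cases h : s = 0
      · simp [h]
      · change s⁻¹ * √s * (s * s * (s⁻¹ * √s)) = s
        field_simp
        rw [sq, h0]
    rwa [← e] at h2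
  rw [norm_matOp_sq, matPolar_mul_matAbsSqrt, ← hC, h, norm_matOp_matAbs]

/-- The operator norm is at most the Hilbert–Schmidt norm, by Cauchy–Schwarz in each row. This bound
produces the function η. -/
theorem norm_matOp_le_sqrt (M : Mat2) :
    ‖matOp M‖ ≤ √(‖M 0 0‖ ^ 2 + ‖M 0 1‖ ^ 2 + ‖M 1 0‖ ^ 2 + ‖M 1 1‖ ^ 2) := by
  refine ContinuousLinearMap.opNorm_le_bound _ (Real.sqrt_nonneg _) fun v => ?_
  rw [EuclideanSpace.norm_eq, EuclideanSpace.norm_eq, ← Real.sqrt_mul (by positivity)]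
  refine Real.sqrt_le_sqrt ?_
  simp only [Fin.sum_univ_two, matOp_apply]
  have key : ∀ a b x y : ℂ, ‖a * x + b * y‖ ^ 2 ≤ (‖a‖ ^ 2 + ‖b‖ ^ 2) * (‖x‖ ^ 2 + ‖y‖ ^ 2) := by
    intro a b x y
    have h1 : ‖a * x + b * y‖ ≤ ‖a‖ * ‖x‖ + ‖b‖ * ‖y‖ := by
      rw [← norm_mul, ← norm_mul]; exact norm_add_le _ _
    have h2 : ‖a * x + b * y‖ ^ 2 ≤ (‖a‖ * ‖x‖ + ‖b‖ * ‖y‖) ^ 2 := by gcongr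
    nlinarith [sq_nonneg (‖a‖ * ‖y‖ - ‖b‖ * ‖x‖)]
  nlinarith [key (M 0 0) (M 0 1) (v 0) (v 1), key (M 1 0) (M 1 1) (v 0) (v 1)]

theorem norm_matOp_le_sum (M : Mat2) :
    ‖matOp M‖ ≤ ‖M 0 0‖ + ‖M 0 1‖ + ‖M 1 0‖ + ‖M 1 1‖ := by
  refine (norm_matOp_le_sqrt M).trans (Real.sqrt_le_iff.2 ⟨by positivity, ?_⟩)
  have := norm_nonneg (M 0 0)
  have := norm_nonneg (M 0 1)
  have := norm_nonneg (M 1 0)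
  have := norm_nonneg (M 1 1)
  nlinarith [mul_nonneg (norm_nonneg (M 0 0)) (norm_nonneg (M 0 1)),
    mul_nonneg (norm_nonneg (M 0 0)) (norm_nonneg (M 1 0)),
    mul_nonneg (norm_nonneg (M 0 0)) (norm_nonneg (M 1 1)),
    mul_nonneg (norm_nonneg (M 0 1)) (norm_nonneg (M 1 0)),
    mul_nonneg (norm_nonneg (M 0 1)) (norm_nonneg (M 1 1)),
    mul_nonneg (norm_nonneg (M 1 0)) (norm_nonneg (M 1 1))]

/-- The larger (`s = 1`) and the smaller (`s = -1`) eigenvalue of a Hermitian `2 × 2` matrix. -/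
def hermEig (s : ℝ) (P : Mat2) : ℝ :=
  ((P 0 0 + P 1 1).re + s * √((P 0 0 + P 1 1).re ^ 2 - 4 * (P 0 0 * P 1 1 - P 0 1 * P 1 0).re)) / 2

/-- A real eigenvalue is a root of the real part of the characteristic polynomial, so the quadratic
formula applies. -/
theorem spectrum_subset_hermEig {P : Mat2} {x : ℝ} (hx : x ∈ _root_.spectrum ℝ P) :
    x = hermEig 1 P ∨ x = hermEig (-1) P := by
  have hdet : (algebraMap ℝ Mat2 x - P).det = 0 := by
    by_contra h
    exact hx ((Matrix.isUnit_iff_isUnit_det _).2 (isUnit_iff_ne_zero.2 h))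
  rw [Matrix.det_fin_two] at hdet
  have e : ∀ i j, algebraMap ℝ Mat2 x i j = if i = j then (x : ℂ) else 0 := fun i j => by
    rw [Matrix.algebraMap_matrix_apply]; rfl
  simp only [Matrix.sub_apply, e] at hdet
  have hre := congrArg Complex.re hdet
  simp at hre
  set T := (P 0 0 + P 1 1).re with hT
  set D := (P 0 0 * P 1 1 - P 0 1 * P 1 0).re with hD
  have hq : x ^ 2 - T * x + D = 0 := by
    rw [hT, hD]; simp; linarith
  have hdisc : 0 ≤ T ^ 2 - 4 * D := by nlinarith [sq_nonneg (2 * x - T)]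
  have hs := Real.mul_self_sqrt hdisc
  have hprod : (x - hermEig 1 P) * (x - hermEig (-1) P) = 0 := by
    simp only [hermEig, ← hT, ← hD]
    linear_combination hq - hs / 4
  rcases mul_eq_zero.1 hprod with h | h
  · exact Or.inl (sub_eq_zero.1 h)
  · exact Or.inr (sub_eq_zero.1 h)

/-- On at most two eigenvalues every function agrees with an affine interpolant. The resulting
formula in the entries of P is what makes |V|^{1/2} and U measurable in x. For a double eigenvalue
the slope is 0/0 = 0, which is harmless. -/
theorem cfc_eq_interpolation (f : ℝ → ℝ) {P : Mat2} (hP : IsSelfAdjoint P) (i j : Fin 2) :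
    cfc f P i j = (f (hermEig 1 P) : ℂ) * (1 : Mat2) i j +
      (((f (hermEig (-1) P) - f (hermEig 1 P)) / (hermEig (-1) P - hermEig 1 P) : ℝ) : ℂ) *
        (P i j - (hermEig 1 P : ℂ) * (1 : Mat2) i j) := by
  set a := hermEig 1 P
  set b := hermEig (-1) P
  set q := (f b - f a) / (b - a)
  have h1 : cfc f P = cfc (fun s : ℝ => (f a - q * a) + q * s) P := by
    refine cfc_congr fun s hs => ?_
    rcases spectrum_subset_hermEig hs with h | h
    · simp only [h]; ring
    · simp only [h]
      change f b = f a - q * a + q * b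
      by_cases hab : b = a
      · rw [hab]; ring
      · have : b - a ≠ 0 := sub_ne_zero.2 hab
        simp only [q]; field_simp; ring
  have h2 : cfc (fun s : ℝ => (f a - q * a) + q * s) P = (f a - q * a) • (1 : Mat2) + q • P := by
    rw [cfc_add _ _ _ (continuousOn_spectrum _) (continuousOn_spectrum _), cfc_const _ _ hP,
      cfc_const_mul _ _ _ (continuousOn_spectrum _), cfc_id' ℝ P hP, Algebra.algebraMap_eq_smul_one]
  rw [h1, h2]
  simp [Matrix.add_apply, Matrix.smul_apply]
  ring

/-- A matrix-valued function with a.e. measurable entries. -/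
def EntryMeas (M : ℝ → Mat2) : Prop := ∀ i j, AEMeasurable (fun t => M t i j) volume

theorem EntryMeas.mul {M N : ℝ → Mat2} (hM : EntryMeas M) (hN : EntryMeas N) :
    EntryMeas fun t => M t * N t := fun i j => by
  simp only [Matrix.mul_apply, Fin.sum_univ_two]
  exact ((hM _ _).mul (hN _ _)).add ((hM _ _).mul (hN _ _))

theorem EntryMeas.conjTranspose {M : ℝ → Mat2} (hM : EntryMeas M) :
    EntryMeas fun t => (M t)ᴴ := fun i j => by
  simp only [Matrix.conjTranspose_apply]
  exact (continuous_star.measurable).comp_aemeasurable (hM j i)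

theorem EntryMeas.hermEig {M : ℝ → Mat2} (hM : EntryMeas M) (s : ℝ) :
    AEMeasurable (fun t => hermEig s (M t)) volume := by
  unfold DiracSpec.hermEig
  have h1 := Complex.measurable_re.comp_aemeasurable ((hM 0 0).add (hM 1 1))
  have h2 := Complex.measurable_re.comp_aemeasurable
    (((hM 0 0).mul (hM 1 1)).sub ((hM 0 1).mul (hM 1 0)))
  exact ((h1.add ((((h1.pow_const 2).sub (h2.const_mul 4)).sqrt).const_mul s)).div_const 2)

theorem EntryMeas.cfc {M : ℝ → Mat2} (hM : EntryMeas M) (hs : ∀ t, IsSelfAdjoint (M t))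
    {f : ℝ → ℝ} (hf : Measurable f) : EntryMeas fun t => cfc f (M t) := fun i j => by
  simp only [fun t => cfc_eq_interpolation f (hs t) i j]
  have ha := hM.hermEig 1
  have hb := hM.hermEig (-1)
  have hfa := hf.comp_aemeasurable ha
  have hfb := hf.comp_aemeasurable hb
  have c := Complex.measurable_ofReal
  exact ((c.comp_aemeasurable hfa).mul_const _).add
    ((c.comp_aemeasurable ((hfb.sub hfa).div (hb.sub ha))).mul
      ((hM i j).sub ((c.comp_aemeasurable ha).mul_const _)))

theorem EntryMeas.matAbs {M : ℝ → Mat2} (hM : EntryMeas M) : EntryMeas fun t => matAbs (M t) :=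
  (hM.conjTranspose.mul hM).cfc (fun t => conjTranspose_mul_self_isSelfAdjoint (M t))
    Real.continuous_sqrt.measurable

theorem EntryMeas.matAbsSqrt {M : ℝ → Mat2} (hM : EntryMeas M) :
    EntryMeas fun t => matAbsSqrt (M t) :=
  hM.matAbs.cfc (fun t => matAbs_isSelfAdjoint (M t)) Real.continuous_sqrt.measurable

theorem EntryMeas.matPolar {M : ℝ → Mat2} (hM : EntryMeas M) :
    EntryMeas fun t => matPolar (M t) :=
  hM.mul (hM.matAbs.cfc (fun t => matAbs_isSelfAdjoint (M t)) measurable_inv)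

theorem EntryMeas.aestronglyMeasurable_apply {M : ℝ → Mat2} (hM : EntryMeas M) {f : ℝ → C2}
    (hf : AEStronglyMeasurable f volume) :
    AEStronglyMeasurable (fun t => matOp (M t) (f t)) volume := by
  have hf' : ∀ j : Fin 2, AEMeasurable (fun t => f t j) volume := fun j =>
    ((EuclideanSpace.proj (𝕜 := ℂ) j).continuous.comp_aestronglyMeasurable hf).aemeasurable
  have h2 : AEMeasurable (fun t => WithLp.ofLp (matOp (M t) (f t))) volume := by
    rw [aemeasurable_pi_iff]
    intro i
    simp only [matOp_apply]
    exact ((hM _ _).mul (hf' _)).add ((hM _ _).mul (hf' _))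
  exact ((PiLp.continuous_toLp 2 _).comp_aestronglyMeasurable h2.aestronglyMeasurable)

theorem matOp_eq_sum (M : Mat2) : matOp M =
    M 0 0 • matOp !![1, 0; 0, 0] + M 0 1 • matOp !![0, 1; 0, 0] +
      M 1 0 • matOp !![0, 0; 1, 0] + M 1 1 • matOp !![0, 0; 0, 1] := by
  simp only [← matOp_smul, ← matOp_add]
  congr 1
  ext i j
  fin_cases i <;> fin_cases j <;> simp

theorem EntryMeas.aestronglyMeasurable_matOp {M : ℝ → Mat2} (hM : EntryMeas M) :
    AEStronglyMeasurable (fun t => matOp (M t)) volume := by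
  simp only [fun t => matOp_eq_sum (M t)]
  exact ((((hM 0 0).aestronglyMeasurable.smul_const _).add
    ((hM 0 1).aestronglyMeasurable.smul_const _)).add
    ((hM 1 0).aestronglyMeasurable.smul_const _)).add
    ((hM 1 1).aestronglyMeasurable.smul_const _)

end MatrixLemmas

/-! ### Convolution operators between L¹, L² and L^∞. -/

section KernelOperators

/-- The Cauchy–Schwarz inequality for `f = (a b)^{1/2}`. -/
theorem lintegral_sq_le_of_sq_le {f a b : ℝ → ℝ≥0∞} (ha : AEMeasurable a volume)
    (hb : AEMeasurable b volume) (h : ∀ x, f x ^ 2 ≤ a x * b x) :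
    (∫⁻ x, f x) ^ 2 ≤ (∫⁻ x, a x) * ∫⁻ x, b x := by
  have h1 : ∀ x, f x ≤ a x ^ (1 / 2 : ℝ) * b x ^ (1 / 2 : ℝ) := fun x => by
    rw [← ENNReal.mul_rpow_of_nonneg _ _ (by norm_num)]
    rw [← ENNReal.rpow_le_rpow_iff (z := 2) (by norm_num), ← ENNReal.rpow_mul]
    simpa using h x
  have h2 := (lintegral_mono h1).trans (ENNReal.lintegral_mul_norm_pow_le (μ := volume) ha hb
    (p := 1 / 2) (q := 1 / 2) (by norm_num) (by norm_num) (by norm_num))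
  calc (∫⁻ x, f x) ^ 2 ≤ ((∫⁻ x, a x) ^ (1 / 2 : ℝ) * (∫⁻ x, b x) ^ (1 / 2 : ℝ)) ^ 2 := by gcongr
    _ = _ := by
      rw [← ENNReal.mul_rpow_of_nonneg _ _ (by norm_num), ← ENNReal.rpow_natCast,
        ← ENNReal.rpow_mul]
      simp

theorem eLpNorm_two_sq {G : Type*} [NormedAddCommGroup G] (g : ℝ → G) :
    eLpNorm g 2 volume ^ 2 = ∫⁻ x, ‖g x‖ₑ ^ 2 := by
  have := eLpNorm_nnreal_pow_eq_lintegral (f := g) (μ := (volume : Measure ℝ)) (p := 2) (by norm_num)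
  simpa using this

theorem toReal_eLpNorm_two_sq {G : Type*} [NormedAddCommGroup G] {g : ℝ → G}
    (hg : MemLp g 2 volume) : (eLpNorm g 2 volume).toReal ^ 2 = ∫ t, ‖g t‖ ^ 2 := by
  rw [← ENNReal.toReal_pow, eLpNorm_two_sq, integral_eq_lintegral_of_nonneg_ae
    (Filter.Eventually.of_forall fun t => by positivity) ((memLp_two_iff_integrable_sq_norm hg.1).1 hg).1]
  congr 1
  refine lintegral_congr fun t => ?_
  rw [ENNReal.ofReal_pow (norm_nonneg _), ofReal_norm]

/-- The integral operator with the convolution kernel `F(x - y)`. -/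
def convK (F : ℝ → C2 →L[ℂ] C2) (g : ℝ → C2) (x : ℝ) : C2 := ∫ y, F (x - y) (g y)

variable {F : ℝ → C2 →L[ℂ] C2} {g : ℝ → C2}

theorem convK_congr {g' : ℝ → C2} (h : g =ᵐ[volume] g') (x : ℝ) : convK F g x = convK F g' x :=
  integral_congr_ae (h.mono fun y hy => by simp only [hy])

theorem aestronglyMeasurable_kernel (hF : AEStronglyMeasurable F volume)
    (hg : AEStronglyMeasurable g volume) :
    AEStronglyMeasurable (fun p : ℝ × ℝ => F (p.1 - p.2) (g p.2))
      ((volume : Measure ℝ).prod (volume : Measure ℝ)) :=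
  AEStronglyMeasurable.convolution_integrand (ContinuousLinearMap.apply ℂ C2) hg hF

theorem aestronglyMeasurable_kernel_snd (hF : AEStronglyMeasurable F volume)
    (hg : AEStronglyMeasurable g volume) (x : ℝ) :
    AEStronglyMeasurable (fun y => F (x - y) (g y)) volume :=
  AEStronglyMeasurable.convolution_integrand_snd (ContinuousLinearMap.apply ℂ C2) hg hF x

theorem aestronglyMeasurable_convK (hF : AEStronglyMeasurable F volume)
    (hg : AEStronglyMeasurable g volume) : AEStronglyMeasurable (convK F g) volume :=
  (aestronglyMeasurable_kernel hF hg).integral_prod_right'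

theorem aemeasurable_shift {G : Type*} [NormedAddCommGroup G] {F : ℝ → G}
    (hF : AEStronglyMeasurable F volume) (x : ℝ) :
    AEMeasurable (fun y => ‖F (x - y)‖ₑ) volume :=
  (hF.comp_quasiMeasurePreserving (quasiMeasurePreserving_sub_left volume x)).enorm

theorem aemeasurable_shift_prod {G : Type*} [NormedAddCommGroup G] {F : ℝ → G}
    (hF : AEStronglyMeasurable F volume) :
    AEMeasurable (fun p : ℝ × ℝ => ‖F (p.1 - p.2)‖ₑ)
      ((volume : Measure ℝ).prod (volume : Measure ℝ)) :=
  (hF.comp_quasiMeasurePreserving (quasiMeasurePreserving_sub volume volume)).enorm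

theorem enorm_convK_le (x : ℝ) : ‖convK F g x‖ₑ ≤ ∫⁻ y, ‖F (x - y)‖ₑ * ‖g y‖ₑ :=
  (enorm_integral_le_lintegral_enorm _).trans
    (lintegral_mono fun _ => ContinuousLinearMap.le_opENorm _ _)

/-- Cauchy–Schwarz in y and invariance of Lebesgue measure under y ↦ x − y; this is the L² to L^∞
bound. -/
theorem lintegral_kernel_sq_le (hF : MemLp F 2 volume) (hg : MemLp g 2 volume) (x : ℝ) :
    (∫⁻ y, ‖F (x - y)‖ₑ * ‖g y‖ₑ) ^ 2 ≤ (eLpNorm F 2 volume * eLpNorm g 2 volume) ^ 2 := by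
  rw [mul_pow, eLpNorm_two_sq, eLpNorm_two_sq,
    ← lintegral_sub_left_eq_self (fun t => ‖F t‖ₑ ^ 2) x]
  exact lintegral_sq_le_of_sq_le ((aemeasurable_shift hF.1 x).pow_const 2) (hg.1.enorm.pow_const 2)
    fun y => (mul_pow _ _ _).le

theorem lintegral_kernel_le (hF : MemLp F 2 volume) (hg : MemLp g 2 volume) (x : ℝ) :
    ∫⁻ y, ‖F (x - y)‖ₑ * ‖g y‖ₑ ≤ eLpNorm F 2 volume * eLpNorm g 2 volume :=
  (ENNReal.pow_le_pow_left_iff two_ne_zero).1 (lintegral_kernel_sq_le hF hg x)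

theorem integrable_kernel_of_memLp (hF : MemLp F 2 volume) (hg : MemLp g 2 volume) (x : ℝ) :
    Integrable (fun y => F (x - y) (g y)) volume := by
  refine ⟨aestronglyMeasurable_kernel_snd hF.1 hg.1 x, ?_⟩
  refine lt_of_le_of_lt ((lintegral_mono fun y => ContinuousLinearMap.le_opENorm _ _).trans
    (lintegral_kernel_le hF hg x)) (ENNReal.mul_lt_top hF.2 hg.2)

theorem integrable_kernel_of_integrable (hF : AEStronglyMeasurable F volume) {c : ℝ}
    (hc : ∀ t, ‖F t‖ ≤ c) (hg : Integrable g volume) (x : ℝ) :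
    Integrable (fun y => F (x - y) (g y)) volume :=
  (hg.norm.const_mul c).mono' (aestronglyMeasurable_kernel_snd hF hg.1 x)
    (Filter.Eventually.of_forall fun y => (F (x - y)).le_of_opNorm_le (hc _) _)

theorem norm_convK_le_of_memLp (hF : MemLp F 2 volume) (hg : MemLp g 2 volume) (x : ℝ) :
    ‖convK F g x‖ ≤ (eLpNorm F 2 volume).toReal * (eLpNorm g 2 volume).toReal := by
  rw [← ENNReal.toReal_mul, ← toReal_enorm]
  exact ENNReal.toReal_mono (ENNReal.mul_lt_top hF.2 hg.2).ne
    ((enorm_convK_le x).trans (lintegral_kernel_le hF hg x))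

theorem norm_convK_le_of_integrable {c : ℝ} (hc : ∀ t, ‖F t‖ ≤ c) (hg : Integrable g volume)
    (x : ℝ) : ‖convK F g x‖ ≤ c * ∫ y, ‖g y‖ := by
  rw [← integral_const_mul]
  exact norm_integral_le_of_norm_le (hg.norm.const_mul c)
    (Filter.Eventually.of_forall fun y => (F (x - y)).le_of_opNorm_le (hc _) _)

/-- Young's inequality: apply Cauchy–Schwarz to |F|^{1/2} · |F|^{1/2}|g|, then Tonelli. -/
theorem eLpNorm_convK_le_of_memLp (hF : Integrable F volume) (hg : MemLp g 2 volume) :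
    eLpNorm (convK F g) 2 volume ≤ eLpNorm F 1 volume * eLpNorm g 2 volume := by
  rw [← ENNReal.pow_le_pow_left_iff two_ne_zero, mul_pow, eLpNorm_two_sq, eLpNorm_two_sq]
  have h1 : ∀ x, ‖convK F g x‖ₑ ^ 2 ≤ eLpNorm F 1 volume * ∫⁻ y, ‖F (x - y)‖ₑ * ‖g y‖ₑ ^ 2 := by
    intro x
    refine (pow_le_pow_left₀ zero_le (enorm_convK_le x) 2).trans ?_
    rw [eLpNorm_one_eq_lintegral_enorm, ← lintegral_sub_left_eq_self (fun t => ‖F t‖ₑ) x]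
    refine lintegral_sq_le_of_sq_le (aemeasurable_shift hF.1 x)
      ((aemeasurable_shift hF.1 x).mul (hg.1.enorm.pow_const 2)) fun y => le_of_eq (by ring)
  refine (lintegral_mono h1).trans ?_
  rw [lintegral_const_mul' _ _ (by simpa [eLpNorm_one_eq_lintegral_enorm] using hF.2.ne)]
  rw [lintegral_lintegral_swap ((aemeasurable_shift_prod hF.1).mul (hg.1.enorm.pow_const 2).comp_snd)]
  simp_rw [fun y => lintegral_mul_const'' (‖g y‖ₑ ^ 2) (f := fun x => ‖F (x - y)‖ₑ) (μ := volume)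
    (hF.comp_sub_right y).1.enorm, lintegral_sub_right_eq_self (fun t => ‖F t‖ₑ)]
  rw [lintegral_const_mul'' _ (hg.1.enorm.pow_const 2), eLpNorm_one_eq_lintegral_enorm, sq, mul_assoc]

/-- The same argument with the factors |F||g|^{1/2} and |g|^{1/2}; this is the L¹ to L² bound. -/
theorem eLpNorm_convK_le_of_integrable (hF : MemLp F 2 volume) (hg : Integrable g volume) :
    eLpNorm (convK F g) 2 volume ≤ eLpNorm F 2 volume * eLpNorm g 1 volume := by
  rw [← ENNReal.pow_le_pow_left_iff two_ne_zero, mul_pow, eLpNorm_two_sq, eLpNorm_two_sq]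
  have h1 : ∀ x, ‖convK F g x‖ₑ ^ 2 ≤ (∫⁻ y, ‖F (x - y)‖ₑ ^ 2 * ‖g y‖ₑ) * eLpNorm g 1 volume := by
    intro x
    refine (pow_le_pow_left₀ zero_le (enorm_convK_le x) 2).trans ?_
    rw [eLpNorm_one_eq_lintegral_enorm]
    refine lintegral_sq_le_of_sq_le (((aemeasurable_shift hF.1 x).pow_const 2).mul hg.1.enorm)
      hg.1.enorm fun y => le_of_eq (by ring)
  refine (lintegral_mono h1).trans ?_
  rw [lintegral_mul_const' _ _ (by simpa [eLpNorm_one_eq_lintegral_enorm] using hg.2.ne)]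
  rw [lintegral_lintegral_swap (((aemeasurable_shift_prod hF.1).pow_const 2).mul hg.1.enorm.comp_snd)]
  have h2 : ∀ y, ∫⁻ x, ‖F (x - y)‖ₑ ^ 2 * ‖g y‖ₑ = (∫⁻ t, ‖F t‖ₑ ^ 2) * ‖g y‖ₑ := fun y => by
    rw [lintegral_mul_const' _ _ enorm_ne_top, lintegral_sub_right_eq_self (fun t => ‖F t‖ₑ ^ 2)]
  simp_rw [h2]
  rw [lintegral_const_mul'' _ hg.1.enorm, eLpNorm_one_eq_lintegral_enorm, sq, mul_assoc]

theorem memLp_convK_of_memLp (hF : Integrable F volume) (hg : MemLp g 2 volume) :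
    MemLp (convK F g) 2 volume := by
  refine ⟨aestronglyMeasurable_convK hF.1 hg.1, (eLpNorm_convK_le_of_memLp hF hg).trans_lt ?_⟩
  exact ENNReal.mul_lt_top (memLp_one_iff_integrable.2 hF).2 hg.2

theorem memLp_convK_of_integrable (hF : MemLp F 2 volume) (hg : Integrable g volume) :
    MemLp (convK F g) 2 volume := by
  refine ⟨aestronglyMeasurable_convK hF.1 hg.1, (eLpNorm_convK_le_of_integrable hF hg).trans_lt ?_⟩
  exact ENNReal.mul_lt_top hF.2 (memLp_one_iff_integrable.2 hg).2

/-- Measurability and integrability of a convolution kernel. -/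
structure IsKernel (F : ℝ → C2 →L[ℂ] C2) : Prop where
  integrable : Integrable F volume
  memLp : MemLp F 2 volume

/-- The bounded operator on `L²(ℝ; ℂ²)` with the convolution kernel `F(x - y)`. -/
def convOp (hF : IsKernel F) : Hil →L[ℂ] Hil :=
  LinearMap.mkContinuous
    { toFun := fun f => (memLp_convK_of_memLp hF.integrable (Lp.memLp f)).toLp
      map_add' := fun f g => by
        rw [← MemLp.toLp_add, MemLp.toLp_eq_toLp_iff]
        refine Filter.Eventually.of_forall fun x => ?_
        rw [convK_congr (Lp.coeFn_add f g)]
        simp only [convK, Pi.add_apply, map_add]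
        exact integral_add (integrable_kernel_of_memLp hF.memLp (Lp.memLp f) x)
          (integrable_kernel_of_memLp hF.memLp (Lp.memLp g) x)
      map_smul' := fun c f => by
        rw [RingHom.id_apply, ← MemLp.toLp_const_smul, MemLp.toLp_eq_toLp_iff]
        refine Filter.Eventually.of_forall fun x => ?_
        rw [convK_congr (Lp.coeFn_smul c f)]
        simp only [convK, Pi.smul_apply, map_smul]
        exact integral_smul c _ }
    (eLpNorm F 1 volume).toReal fun f => by
      change ‖(memLp_convK_of_memLp hF.integrable (Lp.memLp f)).toLp‖ ≤ _
      rw [Lp.norm_toLp, Lp.norm_def, ← ENNReal.toReal_mul]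
      exact ENNReal.toReal_mono (ENNReal.mul_lt_top
        (memLp_one_iff_integrable.2 hF.integrable).2 (Lp.memLp f).2).ne
        (eLpNorm_convK_le_of_memLp hF.integrable (Lp.memLp f))

theorem coeFn_convOp (hF : IsKernel F) (f : Hil) : convOp hF f =ᵐ[volume] convK F f :=
  MemLp.coeFn_toLp (memLp_convK_of_memLp hF.integrable (Lp.memLp f))

/-- Joint integrability of `F(x - y) g(y)` against a square integrable function of `x`. -/
theorem integrable_kernel_prod (hF : IsKernel F) {p q : ℝ → ℝ} (hp : MemLp p 2 volume)
    (hq : MemLp q 2 volume) :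
    Integrable (fun w : ℝ × ℝ => p w.1 * ‖F (w.1 - w.2)‖ * q w.2)
      ((volume : Measure ℝ).prod (volume : Measure ℝ)) := by
  have hp2 := hp.integrable_sq
  have hq2 := hq.integrable_sq
  have i1 : Integrable (fun w : ℝ × ℝ => q w.2 ^ 2 * ‖F (w.1 - w.2)‖)
      ((volume : Measure ℝ).prod (volume : Measure ℝ)) :=
    hq2.convolution_integrand (ContinuousLinearMap.mul ℝ ℝ) hF.integrable.norm
  have i2 : Integrable (fun w : ℝ × ℝ => p w.1 ^ 2 * ‖F (w.1 - w.2)‖)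
      ((volume : Measure ℝ).prod (volume : Measure ℝ)) := by
    have := (hp2.convolution_integrand (ContinuousLinearMap.mul ℝ ℝ)
      (hF.integrable.comp_neg.norm)).swap
    refine this.congr (Filter.Eventually.of_forall fun w => ?_)
    simp
  refine (i1.add i2).mono' ?_ (Filter.Eventually.of_forall fun w => ?_)
  · refine (hp.1.comp_fst.mul ?_).mul hq.1.comp_snd
    exact (hF.1.1.comp_quasiMeasurePreserving (quasiMeasurePreserving_sub volume volume)).norm
  · simp only [Pi.add_apply, norm_mul, Real.norm_eq_abs, abs_norm]
    rw [← sq_abs (p w.1), ← sq_abs (q w.2)]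
    nlinarith [mul_nonneg (norm_nonneg (F (w.1 - w.2))) (sq_nonneg (|p w.1| - |q w.2|)),
      mul_nonneg (norm_nonneg (F (w.1 - w.2))) (sq_nonneg (|p w.1|)),
      mul_nonneg (norm_nonneg (F (w.1 - w.2))) (sq_nonneg (|q w.2|))]

end KernelOperators

/-! ### Adjoints and weak derivatives of convolution operators. -/

section KernelCalculus

variable {F G : ℝ → C2 →L[ℂ] C2}

/-- The hypothesis is F(t)* = G(−t); the rest is Fubini, justified by `integrable_kernel_prod`. -/
theorem convOp_eq_adjoint (hF : IsKernel F) (hG : IsKernel G)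
    (h : ∀ t v w, inner ℂ (F t v) w = inner ℂ v (G (-t) w)) :
    convOp hF = ContinuousLinearMap.adjoint (convOp hG) := by
  rw [ContinuousLinearMap.eq_adjoint_iff]
  intro f g
  rw [L2.inner_def, L2.inner_def]
  have e1 : ∀ᵐ x, inner ℂ (convOp hF f x) (g x) = ∫ y, inner ℂ (F (x - y) (f y)) (g x) := by
    filter_upwards [coeFn_convOp hF f] with x hx
    rw [hx, ← inner_conj_symm, convK, ← integral_inner
      (integrable_kernel_of_memLp hF.memLp (Lp.memLp f) x), ← integral_conj]
    simp only [inner_conj_symm]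
  have e2 : ∀ᵐ y, inner ℂ (f y) (convOp hG g y) = ∫ x, inner ℂ (F (x - y) (f y)) (g x) := by
    filter_upwards [coeFn_convOp hG g] with y hy
    rw [hy, convK, ← integral_inner (integrable_kernel_of_memLp hG.memLp (Lp.memLp g) y)]
    simp only [h, neg_sub]
  rw [integral_congr_ae e1, integral_congr_ae e2]
  refine integral_integral_swap ?_
  refine (integrable_kernel_prod hF (Lp.memLp g).norm (Lp.memLp f).norm).mono' ?_ ?_
  · exact (aestronglyMeasurable_kernel hF.1.1 (Lp.memLp f).1).inner (Lp.memLp g).1.comp_fst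
  · refine Filter.Eventually.of_forall fun w => ?_
    refine (norm_inner_le_norm _ _).trans ?_
    rw [mul_comm, mul_assoc]
    gcongr
    exact ContinuousLinearMap.le_opNorm _ _

theorem memLp_of_test {φ : ℝ → ℝ} (h : Continuous φ) (hc : HasCompactSupport φ) :
    MemLp φ 2 (volume : Measure ℝ) :=
  h.memLp_of_hasCompactSupport hc

theorem integral_smul_convOp (hF : IsKernel F) {φ : ℝ → ℝ} (h : Continuous φ)
    (hc : HasCompactSupport φ) (f : Hil) :
    ∫ x, φ x • convOp hF f x = ∫ y, ∫ x, φ x • F (x - y) (f y) := by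
  have e1 : ∀ᵐ x, φ x • convOp hF f x = ∫ y, φ x • F (x - y) (f y) := by
    filter_upwards [coeFn_convOp hF f] with x hx
    rw [hx, convK, integral_smul]
  rw [integral_congr_ae e1]
  refine integral_integral_swap ?_
  refine (integrable_kernel_prod hF (memLp_of_test h hc).norm (Lp.memLp f).norm).mono' ?_ ?_
  · exact (h.aestronglyMeasurable.comp_fst).smul (aestronglyMeasurable_kernel hF.1.1 (Lp.memLp f).1)
  · refine Filter.Eventually.of_forall fun w => ?_
    simp only [Function.uncurry, norm_smul]
    rw [mul_assoc]
    gcongr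
    exact ContinuousLinearMap.le_opNorm _ _

theorem integrable_integral_smul_kernel (hF : IsKernel F) {φ : ℝ → ℝ} (h : Continuous φ)
    (hc : HasCompactSupport φ) (f : Hil) :
    Integrable (fun y => ∫ x, φ x • F (x - y) (f y)) volume := by
  have : Integrable (fun w : ℝ × ℝ => φ w.1 • F (w.1 - w.2) (f w.2))
      ((volume : Measure ℝ).prod (volume : Measure ℝ)) := by
    refine (integrable_kernel_prod hF (memLp_of_test h hc).norm (Lp.memLp f).norm).mono' ?_ ?_
    · exact (h.aestronglyMeasurable.comp_fst).smul
        (aestronglyMeasurable_kernel hF.1.1 (Lp.memLp f).1)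
    · refine Filter.Eventually.of_forall fun w => ?_
      simp only [norm_smul]
      rw [mul_assoc]
      gcongr
      exact ContinuousLinearMap.le_opNorm _ _
  exact this.integral_prod_right

/-- If the distributional derivative of the kernel `F` is `G + J δ₀`, then the weak derivative of
the convolution `F ∗ f` is `G ∗ f + J f`. -/
theorem convOp_mem_weakDerivGraph (hF : IsKernel F) (hG : IsKernel G) (J : C2 →L[ℂ] C2)
    (hW : ∀ φ : ℝ → ℝ, ContDiff ℝ ∞ φ → HasCompactSupport φ → ∀ y v,
      ∫ x, deriv φ x • F (x - y) v = -(∫ x, φ x • G (x - y) v) - φ y • J v) (f : Hil) :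
    (convOp hF f, convOp hG f + J.compLpL 2 volume f) ∈ weakDerivGraph := by
  intro φ hφ hc
  have hd : Continuous (deriv φ) := hφ.continuous_deriv (by simp)
  change ∫ x, deriv φ x • convOp hF f x = -∫ x, φ x • (convOp hG f + J.compLpL 2 volume f : Hil) x
  have e2 : ∫ x, φ x • (convOp hG f + J.compLpL 2 volume f : Hil) x =
      (∫ x, φ x • convOp hG f x) + ∫ x, φ x • J (f x) := by
    have e3 : (fun x => φ x • J (f x)) =ᵐ[volume] fun x => φ x • (J.compLpL 2 volume f : Hil) x := by
      filter_upwards [ContinuousLinearMap.coeFn_compLpL (p := 2) (μ := volume) J f] with x hx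
      rw [hx]
    rw [integral_congr_ae e3, ← integral_add (integrable_test hφ.continuous hc _)
      (integrable_test hφ.continuous hc _)]
    refine integral_congr_ae ?_
    filter_upwards [Lp.coeFn_add (convOp hG f) (J.compLpL 2 volume f)] with x hx
    rw [hx, Pi.add_apply, smul_add]
  have i3 : Integrable (fun x => φ x • J (f x)) volume := by
    refine (J.integrable_comp (integrable_test hφ.continuous hc f)).congr
      (Filter.Eventually.of_forall fun x => ?_)
    exact ContinuousLinearMap.map_smul_of_tower J _ _
  rw [e2, integral_smul_convOp hF hd hc.deriv, integral_smul_convOp hG hφ.continuous hc,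
    ← integral_add (integrable_integral_smul_kernel hG hφ.continuous hc f) i3, ← integral_neg]
  refine integral_congr_ae (Filter.Eventually.of_forall fun y => ?_)
  simp only [hW φ hφ hc]
  rw [neg_add, sub_eq_add_neg]

theorem freeDirac_apply_of_mem {m : ℝ} {f g : Hil} (h : (f, g) ∈ weakDerivGraph) :
    ∃ hd : f ∈ (freeDirac m).domain, freeDirac m ⟨f, hd⟩ =
      constMat ((-Complex.I) • sigma1) g + constMat ((m : ℂ) • sigma3) f := by
  rw [← weakDeriv_graph, LinearPMap.mem_graph_iff] at h
  obtain ⟨⟨y, hy⟩, rfl, rfl⟩ := h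
  exact ⟨hy, rfl⟩

theorem coeFn_constMat (M : Mat2) (f : Hil) : constMat M f =ᵐ[volume] fun x => matOp M (f x) :=
  ContinuousLinearMap.coeFn_compLpL _ _

/-- F is a fundamental solution: `hFG` is the homogeneous equation off the diagonal, and `hJ` says
that −iσ₁ turns the jump J into the identity. -/
theorem freeDirac_convOp (hF : IsKernel F) (hG : IsKernel G) (J : C2 →L[ℂ] C2)
    (hW : ∀ φ : ℝ → ℝ, ContDiff ℝ ∞ φ → HasCompactSupport φ → ∀ y v,
      ∫ x, deriv φ x • F (x - y) v = -(∫ x, φ x • G (x - y) v) - φ y • J v)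
    {m : ℝ} {z : ℂ}
    (hJ : ∀ v, matOp ((-Complex.I) • sigma1) (J v) = v)
    (hFG : ∀ t v, matOp ((-Complex.I) • sigma1) (G t v) + matOp ((m : ℂ) • sigma3) (F t v) =
      z • F t v) (f : Hil) :
    ∃ hd : convOp hF f ∈ (freeDirac m).domain,
      freeDirac m ⟨convOp hF f, hd⟩ - z • convOp hF f = f := by
  obtain ⟨hd, he⟩ := freeDirac_apply_of_mem (m := m) (convOp_mem_weakDerivGraph hF hG J hW f)
  refine ⟨hd, ?_⟩
  rw [he]
  refine Lp.ext ?_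
  set g := convOp hG f + J.compLpL 2 volume f
  filter_upwards [Lp.coeFn_sub (constMat ((-Complex.I) • sigma1) g +
      constMat ((m : ℂ) • sigma3) (convOp hF f)) (z • convOp hF f),
    Lp.coeFn_add (constMat ((-Complex.I) • sigma1) g) (constMat ((m : ℂ) • sigma3) (convOp hF f)),
    Lp.coeFn_smul z (convOp hF f), coeFn_constMat ((-Complex.I) • sigma1) g,
    coeFn_constMat ((m : ℂ) • sigma3) (convOp hF f), coeFn_convOp hF f, coeFn_convOp hG f,
    Lp.coeFn_add (convOp hG f) (J.compLpL 2 volume f),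
    ContinuousLinearMap.coeFn_compLpL (p := 2) (μ := volume) J f] with x h1 h2 h3 h4 h5 h6 h7 h8 h9
  rw [h1, Pi.sub_apply, h2, Pi.add_apply, h3, Pi.smul_apply, h4, h5, h8, Pi.add_apply, h9, h7, h6,
    map_add, hJ]
  have iF := integrable_kernel_of_memLp hF.memLp (Lp.memLp f) x
  have iG := integrable_kernel_of_memLp hG.memLp (Lp.memLp f) x
  have key : matOp ((-Complex.I) • sigma1) (convK G f x) + matOp ((m : ℂ) • sigma3) (convK F f x) =
      z • convK F f x := by
    simp only [convK]
    rw [← ContinuousLinearMap.integral_comp_comm _ iG, ← ContinuousLinearMap.integral_comp_comm _ iF,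
      ← integral_smul, ← integral_add (ContinuousLinearMap.integrable_comp _ iG)
        (ContinuousLinearMap.integrable_comp _ iF)]
    simp only [hFG]
  rw [← key]
  abel

end KernelCalculus

/-! ### Kernels e^{ik|t|}(M₀ + sgn(t) M₁). -/

section ExponentialKernels

theorem integrable_exp_neg_mul_abs {a : ℝ} (ha : 0 < a) :
    Integrable (fun t : ℝ => Real.exp (-(a * |t|))) volume := by
  have h1 : IntegrableOn (fun t : ℝ => Real.exp (-(a * |t|))) (Set.Ioi 0) volume := by
    refine (integrableOn_exp_mul_Ioi (neg_neg_of_pos ha) 0).congr_fun (fun t ht => ?_)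
      measurableSet_Ioi
    simp only [abs_of_pos (Set.mem_Ioi.1 ht), neg_mul]
  have h2 : IntegrableOn (fun t : ℝ => Real.exp (-(a * |t|))) (Set.Iic 0) volume := by
    refine (integrableOn_exp_mul_Iic ha 0).congr_fun (fun t ht => ?_) measurableSet_Iic
    simp only [abs_of_nonpos (Set.mem_Iic.1 ht), mul_neg, neg_neg]
  rw [← integrableOn_univ, ← Set.Iic_union_Ioi (a := (0 : ℝ))]
  exact h2.union h1

theorem integral_exp_neg_mul_abs {a : ℝ} (ha : 0 < a) :
    ∫ t : ℝ, Real.exp (-(a * |t|)) = 2 / a := by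
  rw [integral_comp_abs (f := fun t => Real.exp (-(a * t)))]
  simp only [← neg_mul]
  rw [integral_exp_mul_Ioi (neg_neg_of_pos ha)]
  simp
  ring

theorem measurable_sign : Measurable Real.sign := by
  unfold Real.sign
  exact Measurable.ite measurableSet_Iio measurable_const
    (Measurable.ite measurableSet_Ioi measurable_const measurable_const)

/-- The convolution kernel `e^{ik|t|} (M₀ + sgn(t) M₁)`. -/
def expKernel (k : ℂ) (M₀ M₁ : C2 →L[ℂ] C2) (t : ℝ) : C2 →L[ℂ] C2 :=
  Complex.exp (Complex.I * k * (|t| : ℝ)) • (M₀ + (Real.sign t : ℂ) • M₁)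

variable {k : ℂ} {M₀ M₁ : C2 →L[ℂ] C2}

theorem norm_exp_I_mul (k : ℂ) (t : ℝ) :
    ‖Complex.exp (Complex.I * k * (t : ℝ))‖ = Real.exp (-(k.im * t)) := by
  rw [Complex.norm_exp]
  congr 1
  simp

theorem norm_expKernel_le {c : ℝ} (hc : ∀ t : ℝ, ‖M₀ + (Real.sign t : ℂ) • M₁‖ ≤ c) (t : ℝ) :
    ‖expKernel k M₀ M₁ t‖ ≤ c * Real.exp (-(k.im * |t|)) := by
  rw [expKernel, norm_smul, norm_exp_I_mul, mul_comm]
  gcongr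
  exact hc t

theorem measurable_expKernel : AEStronglyMeasurable (expKernel k M₀ M₁) volume := by
  have h1 : Continuous fun t : ℝ => Complex.exp (Complex.I * k * (|t| : ℝ)) := by fun_prop
  have h2 : AEStronglyMeasurable (fun t : ℝ => (Real.sign t : ℂ)) volume :=
    (Complex.measurable_ofReal.comp measurable_sign).aestronglyMeasurable
  exact h1.aestronglyMeasurable.smul (aestronglyMeasurable_const.add (h2.smul_const _))

theorem norm_add_sign_smul_le (t : ℝ) : ‖M₀ + (Real.sign t : ℂ) • M₁‖ ≤ ‖M₀‖ + ‖M₁‖ := by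
  refine (norm_add_le _ _).trans ?_
  rw [norm_smul]
  have : ‖(Real.sign t : ℂ)‖ ≤ 1 := by
    rw [Complex.norm_real]
    rcases Real.sign_apply_eq t with h | h | h <;> simp [h]
  nlinarith [norm_nonneg M₁]

theorem isKernel_expKernel (hk : 0 < k.im) : IsKernel (expKernel k M₀ M₁) := by
  have hb := norm_expKernel_le (k := k) (norm_add_sign_smul_le (M₀ := M₀) (M₁ := M₁))
  refine ⟨((integrable_exp_neg_mul_abs hk).const_mul _).mono' measurable_expKernel
    (Filter.Eventually.of_forall hb), ?_⟩
  rw [memLp_two_iff_integrable_sq_norm measurable_expKernel]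
  refine ((integrable_exp_neg_mul_abs (a := 2 * k.im) (by linarith)).const_mul
    ((‖M₀‖ + ‖M₁‖) ^ 2)).mono' (measurable_expKernel.norm.pow 2)
    (Filter.Eventually.of_forall fun t => ?_)
  rw [norm_pow, norm_norm]
  refine (pow_le_pow_left₀ (norm_nonneg _) (hb t) 2).trans (le_of_eq ?_)
  rw [mul_pow, ← Real.exp_nat_mul]
  congr 2
  push_cast
  ring

/-- The square of the envelope integrates to c² ∫ e^{−2(Im k)|t|} dt = c²/Im k. -/
theorem eLpNorm_expKernel_le (hk : 0 < k.im) {c : ℝ}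
    (hc : ∀ t : ℝ, ‖M₀ + (Real.sign t : ℂ) • M₁‖ ≤ c) :
    (eLpNorm (expKernel k M₀ M₁) 2 volume).toReal ≤ c / √k.im := by
  have hc0 : 0 ≤ c := (norm_nonneg _).trans (hc 0)
  have hb := norm_expKernel_le (k := k) hc
  have hF := (isKernel_expKernel (M₀ := M₀) (M₁ := M₁) hk).memLp
  have hi := (memLp_two_iff_integrable_sq_norm hF.1).1 hF
  have h2 : ∫ t, ‖expKernel k M₀ M₁ t‖ ^ 2 ≤ c ^ 2 / k.im := by
    calc ∫ t, ‖expKernel k M₀ M₁ t‖ ^ 2 ≤ ∫ t : ℝ, c ^ 2 * Real.exp (-(2 * k.im * |t|)) := by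
          refine integral_mono hi
            ((integrable_exp_neg_mul_abs (a := 2 * k.im) (by linarith)).const_mul _) fun t => ?_
          refine (pow_le_pow_left₀ (norm_nonneg _) (hb t) 2).trans (le_of_eq ?_)
          rw [mul_pow, ← Real.exp_nat_mul]
          congr 2
          push_cast
          ring
      _ = c ^ 2 / k.im := by
          rw [integral_const_mul, integral_exp_neg_mul_abs (by linarith)]
          field_simp
  rw [← toReal_eLpNorm_two_sq hF] at h2
  rw [← pow_le_pow_iff_left₀ ENNReal.toReal_nonneg (by positivity) two_ne_zero, div_pow,
    Real.sq_sqrt hk.le]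
  exact h2

theorem hasDerivAt_smul_exp_smul {φ : ℝ → ℝ} (hφ : Differentiable ℝ φ) (c : ℂ) (y : ℝ) (a : C2)
    (x : ℝ) :
    HasDerivAt (fun x : ℝ => φ x • Complex.exp (c * ((x - y : ℝ) : ℂ)) • a)
      (φ x • (c * Complex.exp (c * ((x - y : ℝ) : ℂ))) • a +
        deriv φ x • Complex.exp (c * ((x - y : ℝ) : ℂ)) • a) x := by
  have h1 : HasDerivAt (fun x : ℝ => Complex.exp (c * ((x - y : ℝ) : ℂ)))
      (c * Complex.exp (c * ((x - y : ℝ) : ℂ))) x := by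
    have h2 : HasDerivAt (fun x : ℝ => c * ((x - y : ℝ) : ℂ)) c x := by
      simpa using (((hasDerivAt_id x).sub_const y).ofReal_comp).const_mul c
    simpa [mul_comm] using h2.cexp
  exact (hφ x).hasDerivAt.smul (h1.smul_const a)

theorem integrable_smul_exp_smul {φ : ℝ → ℝ} (h : Continuous φ) (hc : HasCompactSupport φ)
    (c d : ℂ) (y : ℝ) (a : C2) :
    Integrable (fun x : ℝ => φ x • (d * Complex.exp (c * ((x - y : ℝ) : ℂ))) • a) volume := by
  refine Continuous.integrable_of_hasCompactSupport (by fun_prop) ?_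
  exact hc.smul_right

/-- Integration by parts on a half line: compact support removes the boundary term at infinity, and
the one at y remains. -/
theorem integral_Ioi_deriv_smul_exp {φ : ℝ → ℝ} (hφ : ContDiff ℝ ∞ φ) (hc : HasCompactSupport φ)
    (c : ℂ) (y : ℝ) (a : C2) :
    ∫ x in Set.Ioi y, deriv φ x • Complex.exp (c * ((x - y : ℝ) : ℂ)) • a =
      -(∫ x in Set.Ioi y, φ x • (c * Complex.exp (c * ((x - y : ℝ) : ℂ))) • a) - φ y • a := by
  have hd : Continuous (deriv φ) := hφ.continuous_deriv (by simp)
  have i1 := (integrable_smul_exp_smul hφ.continuous hc c c y a).integrableOn (s := Set.Ioi y)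
  have i2 := (integrable_smul_exp_smul hd hc.deriv c 1 y a).integrableOn (s := Set.Ioi y)
  simp only [one_mul] at i2
  have hD := hasDerivAt_smul_exp_smul (hφ.differentiable (by simp)) c y a
  have h := integral_Ioi_of_hasDerivAt_of_tendsto (m := (0 : C2)) (a := y)
    (hD y).continuousAt.continuousWithinAt (fun x _ => hD x) (i1.add i2) ?_
  · rw [integral_add i1 i2] at h
    simp only [sub_self, Complex.ofReal_zero, mul_zero, Complex.exp_zero, one_smul, zero_sub] at h
    rw [sub_eq_add_neg _ (φ y • a), ← h]
    abel
  · have : HasCompactSupport fun x : ℝ => φ x • Complex.exp (c * ((x - y : ℝ) : ℂ)) • a :=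
      hc.smul_right
    exact this.is_zero_at_infty.mono_left atTop_le_cocompact

theorem integral_Iic_deriv_smul_exp {φ : ℝ → ℝ} (hφ : ContDiff ℝ ∞ φ) (hc : HasCompactSupport φ)
    (c : ℂ) (y : ℝ) (a : C2) :
    ∫ x in Set.Iic y, deriv φ x • Complex.exp (c * ((x - y : ℝ) : ℂ)) • a =
      -(∫ x in Set.Iic y, φ x • (c * Complex.exp (c * ((x - y : ℝ) : ℂ))) • a) + φ y • a := by
  have hd : Continuous (deriv φ) := hφ.continuous_deriv (by simp)
  have i1 := (integrable_smul_exp_smul hφ.continuous hc c c y a).integrableOn (s := Set.Iic y)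
  have i2 := (integrable_smul_exp_smul hd hc.deriv c 1 y a).integrableOn (s := Set.Iic y)
  simp only [one_mul] at i2
  have hD := hasDerivAt_smul_exp_smul (hφ.differentiable (by simp)) c y a
  have h := integral_Iic_of_hasDerivAt_of_tendsto (m := (0 : C2)) (a := y)
    (hD y).continuousAt.continuousWithinAt (fun x _ => hD x) (i1.add i2) ?_
  · rw [integral_add i1 i2] at h
    simp only [sub_self, Complex.ofReal_zero, mul_zero, Complex.exp_zero, one_smul, sub_zero] at h
    rw [← h]
    abel
  · have : HasCompactSupport fun x : ℝ => φ x • Complex.exp (c * ((x - y : ℝ) : ℂ)) • a :=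
      hc.smul_right
    exact this.is_zero_at_infty.mono_left atBot_le_cocompact

theorem expKernel_of_pos {t : ℝ} (ht : 0 < t) (v : C2) :
    expKernel k M₀ M₁ t v = Complex.exp (Complex.I * k * (t : ℂ)) • (M₀ v + M₁ v) := by
  simp [expKernel, Real.sign_of_pos ht, abs_of_pos ht]

theorem expKernel_of_neg {t : ℝ} (ht : t < 0) (v : C2) :
    expKernel k M₀ M₁ t v = Complex.exp (-(Complex.I * k) * (t : ℂ)) • (M₀ v - M₁ v) := by
  simp [expKernel, Real.sign_of_neg ht, abs_of_neg ht, sub_eq_add_neg]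

theorem integral_smul_expKernel {φ : ℝ → ℝ} (h : Continuous φ) (hc : HasCompactSupport φ)
    (y : ℝ) (v : C2) :
    ∫ x, φ x • expKernel k M₀ M₁ (x - y) v =
      (∫ x in Set.Iic y, φ x • Complex.exp (-(Complex.I * k) * ((x - y : ℝ) : ℂ)) • (M₀ v - M₁ v)) +
      ∫ x in Set.Ioi y, φ x • Complex.exp (Complex.I * k * ((x - y : ℝ) : ℂ)) • (M₀ v + M₁ v) := by
  have i1 := (integrable_smul_exp_smul h hc (-(Complex.I * k)) 1 y (M₀ v - M₁ v)).integrableOn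
    (s := Set.Iio y)
  have i2 := (integrable_smul_exp_smul h hc (Complex.I * k) 1 y (M₀ v + M₁ v)).integrableOn
    (s := Set.Ioi y)
  simp only [one_mul] at i1 i2
  have e1 : Set.EqOn
      (fun x => φ x • Complex.exp (-(Complex.I * k) * ((x - y : ℝ) : ℂ)) • (M₀ v - M₁ v))
      (fun x => φ x • expKernel k M₀ M₁ (x - y) v) (Set.Iio y) := fun x hx => by
    simp only [expKernel_of_neg (sub_neg.2 (Set.mem_Iio.1 hx))]
  have e2 : Set.EqOn
      (fun x => φ x • Complex.exp (Complex.I * k * ((x - y : ℝ) : ℂ)) • (M₀ v + M₁ v))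
      (fun x => φ x • expKernel k M₀ M₁ (x - y) v) (Set.Ioi y) := fun x hx => by
    simp only [expKernel_of_pos (sub_pos.2 (Set.mem_Ioi.1 hx))]
  have j1 := i1.congr_fun e1 measurableSet_Iio
  have j2 := i2.congr_fun e2 measurableSet_Ioi
  rw [integral_Iic_eq_integral_Iio, setIntegral_congr_fun measurableSet_Iio e1,
    setIntegral_congr_fun measurableSet_Ioi e2, ← integral_Iic_eq_integral_Iio]
  refine (intervalIntegral.integral_Iic_add_Ioi ?_ j2).symm
  rwa [integrableOn_Iic_iff_integrableOn_Iio]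

/-- The distributional derivative of an exponential kernel. -/
theorem integral_deriv_smul_expKernel {φ : ℝ → ℝ} (hφ : ContDiff ℝ ∞ φ) (hc : HasCompactSupport φ)
    (y : ℝ) (v : C2) :
    ∫ x, deriv φ x • expKernel k M₀ M₁ (x - y) v =
      -(∫ x, φ x • expKernel k ((Complex.I * k) • M₁) ((Complex.I * k) • M₀) (x - y) v) -
        φ y • ((2 : ℂ) • M₁) v := by
  have hd : Continuous (deriv φ) := hφ.continuous_deriv (by simp)
  rw [integral_smul_expKernel hd hc.deriv, integral_smul_expKernel hφ.continuous hc,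
    integral_Ioi_deriv_smul_exp hφ hc, integral_Iic_deriv_smul_exp hφ hc]
  -- Differentiating e^{ik|t|} yields ik sgn(t), which exchanges the roles of M₀ and M₁ since sgn² =
  -- 1 off the origin.
  have e1 : ∀ x : ℝ, φ x • (-(Complex.I * k) * Complex.exp (-(Complex.I * k) * ((x - y : ℝ) : ℂ))) •
      (M₀ v - M₁ v) = φ x • Complex.exp (-(Complex.I * k) * ((x - y : ℝ) : ℂ)) •
        (((Complex.I * k) • M₁) v - ((Complex.I * k) • M₀) v) := fun x => by
    congr 1
    simp only [_root_.smul_apply]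
    module
  have e2 : ∀ x : ℝ, φ x • (Complex.I * k * Complex.exp (Complex.I * k * ((x - y : ℝ) : ℂ))) •
      (M₀ v + M₁ v) = φ x • Complex.exp (Complex.I * k * ((x - y : ℝ) : ℂ)) •
        (((Complex.I * k) • M₁) v + ((Complex.I * k) • M₀) v) := fun x => by
    congr 1
    simp only [_root_.smul_apply]
    module
  simp only [e1, e2]
  -- The jump at t = 0 is (M₀ + M₁) − (M₀ − M₁).
  have e3 : φ y • ((2 : ℂ) • M₁) v = φ y • (M₀ v + M₁ v) - φ y • (M₀ v - M₁ v) := by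
    rw [← smul_sub]
    congr 1
    simp only [_root_.smul_apply]
    module
  rw [e3]
  abel

end ExponentialKernels

/-! ### The kernel of the free resolvent, and its normality. -/

section FreeResolvent

/-- The even part of the free resolvent kernel. -/
def diracEven (ζ : ℂ) : Mat2 := (Complex.I / 2) • !![ζ, 0; 0, ζ⁻¹]

/-- The odd part of the free resolvent kernel. -/
def diracOdd : Mat2 := (Complex.I / 2) • sigma1

/-- The convolution kernel of `(H₀ - z)⁻¹`, where `k² = z² - m²` and `Im k > 0`. -/
def diracKernel (m : ℝ) (z k : ℂ) : ℝ → C2 →L[ℂ] C2 :=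
  expKernel k (matOp (diracEven ((z + m) / k))) (matOp diracOdd)

variable {m : ℝ} {z k : ℂ}

theorem isKernel_diracKernel (hk : 0 < k.im) : IsKernel (diracKernel m z k) :=
  isKernel_expKernel hk

theorem ne_zero_of_im_pos (hk : 0 < k.im) : k ≠ 0 := fun h => by simp [h] at hk

/-- From (z + m)(z − m) = k² one gets kζ = z + m and k/ζ = z − m; these are the even and odd parts
of the homogeneous equation. The jump is iσ₁, the inverse of −iσ₁. -/
theorem freeDirac_convOp_diracKernel (hk : 0 < k.im) (hkz : k ^ 2 = z ^ 2 - (m : ℂ) ^ 2) (f : Hil) :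
    ∃ hd : convOp (isKernel_diracKernel (m := m) (z := z) hk) f ∈ (freeDirac m).domain,
      freeDirac m ⟨convOp (isKernel_diracKernel (m := m) (z := z) hk) f, hd⟩ -
        z • convOp (isKernel_diracKernel (m := m) (z := z) hk) f = f := by
  have hk0 := ne_zero_of_im_pos hk
  have hfac : (z + m) * (z - m) = k ^ 2 := by rw [hkz]; ring
  have hzm : z + m ≠ 0 := fun h => by
    rw [h, zero_mul] at hfac
    exact hk0 (pow_eq_zero_iff two_ne_zero |>.1 hfac.symm)
  have hI := Complex.I_sq
  obtain ⟨ζ, hζ⟩ : ∃ ζ, ζ = (z + m) / k := ⟨_, rfl⟩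
  have e1 : ζ * (z - m) = k := by rw [hζ]; field_simp; linear_combination hfac
  have e2 : ζ⁻¹ * (z + m) = k := by rw [hζ]; field_simp
  have e3 : k * ζ = z + m := by rw [hζ]; field_simp
  have e4 : k * ζ⁻¹ = z - m := by rw [hζ]; field_simp; linear_combination -hfac
  refine freeDirac_convOp (isKernel_diracKernel hk)
    (isKernel_expKernel (M₀ := (Complex.I * k) • matOp diracOdd)
      (M₁ := (Complex.I * k) • matOp (diracEven ((z + m) / k))) hk) ((2 : ℂ) • matOp diracOdd)
    (fun φ hφ hc y v => integral_deriv_smul_expKernel hφ hc y v) ?_ ?_ f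
  · intro v
    rw [← matOp_smul, ← matOp_mul_apply]
    have : (-Complex.I) • sigma1 * (2 : ℂ) • diracOdd = 1 := by
      ext i j
      fin_cases i <;> fin_cases j <;> simp [diracOdd, sigma1, Matrix.mul_apply, Fin.sum_univ_two] <;>
        linear_combination (-1) * hI
    rw [this, matOp_one]
    rfl
  · intro t v
    have h1 : ((-Complex.I) • sigma1) * ((Complex.I * k) • diracOdd) +
        ((m : ℂ) • sigma3) * diracEven ((z + m) / k) = z • diracEven ((z + m) / k) := by
      ext i j
      fin_cases i <;> fin_cases j <;>
        simp [diracOdd, diracEven, sigma1, sigma3, ← hζ]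
      · linear_combination -(Complex.I * k / 2) * hI - (Complex.I / 2) * e1
      · linear_combination -(Complex.I * k / 2) * hI - (Complex.I / 2) * e2
    have h2 : ((-Complex.I) • sigma1) * ((Complex.I * k) • diracEven ((z + m) / k)) +
        ((m : ℂ) • sigma3) * diracOdd = z • diracOdd := by
      ext i j
      fin_cases i <;> fin_cases j <;>
        simp [diracOdd, diracEven, sigma1, sigma3, ← hζ]
      · linear_combination -(Complex.I * k * ζ⁻¹ / 2) * hI + (Complex.I / 2) * e4
      · linear_combination -(Complex.I * k * ζ / 2) * hI + (Complex.I / 2) * e3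
    have h1' := congrArg (fun M => matOp M v) h1
    have h2' := congrArg (fun M => matOp M v) h2
    simp only [matOp_add, matOp_smul, matOp_mul, _root_.add_apply, _root_.smul_apply,
      ContinuousLinearMap.comp_apply, map_smul] at h1' h2'
    simp only [diracKernel, expKernel, _root_.add_apply, _root_.smul_apply, map_add, map_smul,
      matOp_smul]
    linear_combination (norm := module) (Complex.exp (Complex.I * k * (|t| : ℝ))) • h1' +
      (Complex.exp (Complex.I * k * (|t| : ℝ)) * (Real.sign t : ℂ)) • h2'

/-- The squared Hilbert–Schmidt norm is (|ζ|² + |ζ|⁻² + 2 sgn(t)²)/4, and |ζ|² = |Φ(z)|; this is at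
most η². -/
theorem norm_diracKernel_coeff_le (hk : 0 < k.im) (hkz : k ^ 2 = z ^ 2 - (m : ℂ) ^ 2) (t : ℝ) :
    ‖matOp (diracEven ((z + m) / k)) + (Real.sign t : ℂ) • matOp diracOdd‖ ≤ eta ‖Phi m z‖ := by
  have hk0 := ne_zero_of_im_pos hk
  have hfac : (z + m) * (z - m) = k ^ 2 := by rw [hkz]; ring
  have hzm : z + m ≠ 0 := fun h => by
    rw [h, zero_mul] at hfac
    exact hk0 (pow_eq_zero_iff two_ne_zero |>.1 hfac.symm)
  have hzm' : z - m ≠ 0 := fun h => by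
    rw [h, mul_zero] at hfac
    exact hk0 (pow_eq_zero_iff two_ne_zero |>.1 hfac.symm)
  have hPhi : Phi m z = ((z + m) / k) ^ 2 := by
    rw [Phi, div_pow, ← hfac]
    field_simp
  rw [← matOp_smul, ← matOp_add]
  refine (norm_matOp_le_sqrt _).trans (Real.sqrt_le_sqrt ?_)
  have hs : ‖(Real.sign t : ℂ)‖ ^ 2 ≤ 1 := by
    rw [Complex.norm_real]
    rcases Real.sign_apply_eq t with h | h | h <;> simp [h]
  rw [hPhi, norm_pow]
  generalize (z + m) / k = ζ
  generalize (Real.sign t : ℂ) = s at hs ⊢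
  simp only [diracEven, diracOdd, sigma1, Matrix.add_apply, Matrix.smul_apply, smul_eq_mul,
    Matrix.of_apply, Matrix.cons_val', Matrix.cons_val_zero, Matrix.cons_val_one, mul_zero, mul_one,
    zero_add, add_zero, norm_mul, norm_div, Complex.norm_I, Complex.norm_ofNat, norm_inv, mul_pow,
    inv_pow, Matrix.cons_val_fin_one]
  nlinarith

/-- Conjugation takes z to z̄ and the root k to −k̄, which again lies in the upper half plane. -/
theorem adjoint_convOp_diracKernel (hk : 0 < k.im)
    (hk' : 0 < (-(starRingEnd ℂ) k).im) :
    convOp (isKernel_diracKernel (m := m) (z := (starRingEnd ℂ) z) hk') =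
      ContinuousLinearMap.adjoint (convOp (isKernel_diracKernel (m := m) (z := z) hk)) := by
  refine convOp_eq_adjoint _ _ fun t v w => ?_
  have h0 : diracEven (((starRingEnd ℂ) z + m) / -(starRingEnd ℂ) k) =
      (diracEven ((z + m) / k))ᴴ := by
    ext i j
    fin_cases i <;> fin_cases j <;> simp [diracEven] <;> ring
  have h1 : diracOdd = -(diracOdd)ᴴ := by
    ext i j
    fin_cases i <;> fin_cases j <;> simp [diracOdd, sigma1] <;> ring
  have hM : ∀ (M : Mat2), inner ℂ (matOp Mᴴ v) w = inner ℂ v (matOp M w) := fun M => by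
    rw [matOp_conjTranspose]
    exact ContinuousLinearMap.adjoint_inner_left _ _ _
  have h1' : inner ℂ (matOp diracOdd v) w = -inner ℂ v (matOp diracOdd w) := by
    rw [← hM, ← inner_neg_left]
    congr 1
    have := congrArg (fun M => matOp M v) h1
    rw [← neg_one_smul ℂ, matOp_smul] at this
    simpa using this
  have he : (starRingEnd ℂ) (Complex.exp (Complex.I * -(starRingEnd ℂ) k * (|t| : ℝ))) =
      Complex.exp (Complex.I * k * (|t| : ℝ)) := by
    rw [← Complex.exp_conj]
    simp
  simp only [diracKernel, expKernel, _root_.smul_apply, _root_.add_apply, inner_smul_left,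
    inner_smul_right, inner_add_left, inner_add_right, h0, hM, h1', he, Real.sign_neg, abs_neg,
    Complex.conj_ofReal, Complex.ofReal_neg]
  ring

/-- The antilinear symmetry `v ↦ σ₃ v̄` of the Dirac operator. -/
def diracConj : C2 →L[ℝ] C2 :=
  LinearMap.toContinuousLinearMap
    { toFun := fun v => WithLp.toLp 2 ![(starRingEnd ℂ) (v 0), -(starRingEnd ℂ) (v 1)]
      map_add' := fun v w => by
        ext i
        fin_cases i
        · simp
        · simp; ring
      map_smul' := fun c v => by
        ext i
        fin_cases i <;> simp }

theorem diracConj_zero (v : C2) : diracConj v 0 = (starRingEnd ℂ) (v 0) := rfl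

theorem diracConj_one (v : C2) : diracConj v 1 = -(starRingEnd ℂ) (v 1) := rfl

theorem diracConj_comp_mem_weakDerivGraph {f g : Hil} (h : (f, g) ∈ weakDerivGraph) :
    (diracConj.compLp f, diracConj.compLp g) ∈ weakDerivGraph := by
  intro φ hφ hc
  have hd : Continuous (deriv φ) := hφ.continuous_deriv (by simp)
  have key : ∀ {ψ : ℝ → ℝ}, Continuous ψ → HasCompactSupport ψ → ∀ u : Hil,
      ∫ x, ψ x • (diracConj.compLp u : Hil) x = diracConj (∫ x, ψ x • u x) := by
    intro ψ hψ hψc u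
    rw [← ContinuousLinearMap.integral_comp_comm _ (integrable_test hψ hψc u)]
    refine integral_congr_ae ?_
    filter_upwards [diracConj.coeFn_compLp u] with x hx
    rw [hx, map_smul]
  have := h φ hφ hc
  simp only at this ⊢
  rw [key hd hc.deriv, key hφ.continuous hc, this, map_neg]

/-- Complex conjugation turns −iσ₁ into iσ₁, and σ₃ anticommutes with σ₁ and restores the sign. So v
↦ σ₃v̄ takes eigenfunctions for z̄ to eigenfunctions for z. -/
theorem diracConj_freeDirac (v w : C2) (z : ℂ)
    (h : matOp ((-Complex.I) • sigma1) w + matOp ((m : ℂ) • sigma3) v = (starRingEnd ℂ) z • v) :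
    matOp ((-Complex.I) • sigma1) (diracConj w) + matOp ((m : ℂ) • sigma3) (diracConj v) =
      z • diracConj v := by
  have h0 := congrArg (fun u : C2 => (starRingEnd ℂ) (u 0)) h
  have h1 := congrArg (fun u : C2 => (starRingEnd ℂ) (u 1)) h
  simp [matOp_apply, sigma1, sigma3] at h0 h1
  ext i
  fin_cases i
  · simp [matOp_apply, sigma1, sigma3, diracConj_zero, diracConj_one]
    linear_combination h0
  · simp [matOp_apply, sigma1, sigma3, diracConj_zero, diracConj_one]
    linear_combination -h1

theorem freeDirac_domain_graph (f : (freeDirac m).domain) :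
    ∃ g : Hil, ((f : Hil), g) ∈ weakDerivGraph ∧ freeDirac m f =
      constMat ((-Complex.I) • sigma1) g + constMat ((m : ℂ) • sigma3) (f : Hil) := by
  refine ⟨weakDeriv ⟨f, f.2⟩, ?_, rfl⟩
  rw [← weakDeriv_graph, LinearPMap.mem_graph_iff]
  exact ⟨⟨f, f.2⟩, rfl, rfl⟩

theorem coeFn_constMat_add (M N : Mat2) (f g : Hil) :
    (constMat M g + constMat N f : Hil) =ᵐ[volume] fun x => matOp M (g x) + matOp N (f x) := by
  filter_upwards [Lp.coeFn_add (constMat M g) (constMat N f), coeFn_constMat M g,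
    coeFn_constMat N f] with x h1 h2 h3
  rw [h1, Pi.add_apply, h2, h3]

/-- If `z ∈ ρ(H₀)`, then `conj z` is not an eigenvalue of `H₀`. -/
theorem freeDirac_conj_injective (hz : z ∈ resolventSet (freeDirac m)) (f : (freeDirac m).domain)
    (hf : freeDirac m f - (starRingEnd ℂ) z • (f : Hil) = 0) : f = 0 := by
  obtain ⟨g, hg, hfg⟩ := freeDirac_domain_graph f
  rw [hfg, sub_eq_zero] at hf
  obtain ⟨hd, he⟩ := freeDirac_apply_of_mem (m := m) (diracConj_comp_mem_weakDerivGraph hg)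
  have h0 : freeDirac m ⟨diracConj.compLp f, hd⟩ - z • diracConj.compLp (f : Hil) = 0 := by
    rw [he, sub_eq_zero]
    refine Lp.ext ?_
    filter_upwards [coeFn_constMat_add ((-Complex.I) • sigma1) ((m : ℂ) • sigma3) (f : Hil) g,
      coeFn_constMat_add ((-Complex.I) • sigma1) ((m : ℂ) • sigma3) (diracConj.compLp (f : Hil))
        (diracConj.compLp g), Lp.coeFn_smul ((starRingEnd ℂ) z) (f : Hil),
      Lp.coeFn_smul z (diracConj.compLp (f : Hil)), diracConj.coeFn_compLp (f : Hil),
      diracConj.coeFn_compLp g] with x h1 h2 h3 h4 h5 h6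
    rw [h2, h4, Pi.smul_apply, h5, h6]
    refine diracConj_freeDirac _ _ _ ?_
    rw [← h1, hf, h3, Pi.smul_apply]
  have h1 := (isResolventAt_resolvent hz).2 ⟨_, hd⟩
  simp only [h0, map_zero] at h1
  refine Subtype.ext (Lp.ext ?_)
  have h2 : (0 : Hil) = diracConj.compLp (f : Hil) := h1
  filter_upwards [diracConj.coeFn_compLp (f : Hil), Lp.coeFn_zero C2 2 (volume : Measure ℝ)]
    with x h3 h4
  rw [← h2, h4] at h3
  have e0 := congrArg (fun u : C2 => u 0) h3
  have e1 := congrArg (fun u : C2 => u 1) h3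
  simp only [diracConj_zero, diracConj_one, PiLp.zero_apply, Pi.zero_apply] at e0 e1
  have e0' := (map_eq_zero (starRingEnd ℂ)).1 e0.symm
  have e1' := (map_eq_zero (starRingEnd ℂ)).1 (neg_eq_zero.1 e1.symm)
  rw [ZeroMemClass.coe_zero, h4]
  ext i
  fin_cases i <;> simp [e0', e1']

theorem isResolventAt_of_rightInverse {T : Hil →ₗ.[ℂ] Hil} {w : ℂ} {R : Hil →L[ℂ] Hil}
    (h1 : ∀ g, ∃ h : R g ∈ T.domain, T ⟨R g, h⟩ - w • R g = g)
    (h2 : ∀ f : T.domain, T f - w • (f : Hil) = 0 → f = 0) : IsResolventAt T w R := by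
  refine ⟨h1, fun f => ?_⟩
  obtain ⟨hd, he⟩ := h1 (T f - w • (f : Hil))
  have := h2 (⟨_, hd⟩ - f) (by
    rw [LinearPMap.map_sub, AddSubgroupClass.coe_sub, smul_sub]
    rw [← sub_eq_zero] at he
    rw [← he]
    abel)
  exact congrArg Subtype.val (sub_eq_zero.1 this)

theorem resolvent_freeDirac_eq (hz : z ∈ resolventSet (freeDirac m)) (hk : 0 < k.im)
    (hkz : k ^ 2 = z ^ 2 - (m : ℂ) ^ 2) :
    resolvent (freeDirac m) z = convOp (isKernel_diracKernel (m := m) (z := z) hk) := by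
  ext1 f
  obtain ⟨hd, he⟩ := freeDirac_convOp_diracKernel (m := m) hk hkz f
  have := (isResolventAt_resolvent hz).2 ⟨_, hd⟩
  exact (congrArg _ he.symm).trans this

/-- The adjoint is the convolution operator attached to z̄. It is a right inverse of H₀ − z̄, hence
the resolvent there by `freeDirac_conj_injective`, and resolvents commute. Self-adjointness of H₀ is
not invoked. -/
theorem isStarNormal_resolvent_freeDirac (hz : z ∈ resolventSet (freeDirac m)) (hk : 0 < k.im)
    (hkz : k ^ 2 = z ^ 2 - (m : ℂ) ^ 2) : IsStarNormal (resolvent (freeDirac m) z) := by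
  have hk' : 0 < (-(starRingEnd ℂ) k).im := by simpa using hk
  have hkz' : (-(starRingEnd ℂ) k) ^ 2 = ((starRingEnd ℂ) z) ^ 2 - (m : ℂ) ^ 2 := by
    have := congrArg (starRingEnd ℂ) hkz
    simpa using this
  have h := isResolventAt_of_rightInverse
    (freeDirac_convOp_diracKernel (m := m) (z := (starRingEnd ℂ) z) hk' hkz')
    (freeDirac_conj_injective hz)
  rw [adjoint_convOp_diracKernel hk hk', ← resolvent_freeDirac_eq hz hk hkz] at h
  exact ⟨h.commute (isResolventAt_resolvent hz)⟩

end FreeResolvent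

/-! ### Plane waves and the spectrum of the free operator. -/

section EssentialSpectrum

theorem mem_weakDerivGraph_of_hasDerivAt {u u' : ℝ → C2} (hu : ∀ x, HasDerivAt u (u' x) x)
    (hc' : Continuous u') (h : MemLp u 2 volume) (h' : MemLp u' 2 volume) :
    (h.toLp, h'.toLp) ∈ weakDerivGraph := by
  intro φ hφ hc
  have hcu : Continuous u := continuous_iff_continuousAt.2 fun x => (hu x).continuousAt
  have hd : Continuous (deriv φ) := hφ.continuous_deriv (by simp)
  have e1 : ∫ x, deriv φ x • (h.toLp : ℝ → C2) x = ∫ x, deriv φ x • u x := by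
    refine integral_congr_ae ?_
    filter_upwards [h.coeFn_toLp] with x hx
    rw [hx]
  have e2 : ∫ x, φ x • (h'.toLp : ℝ → C2) x = ∫ x, φ x • u' x := by
    refine integral_congr_ae ?_
    filter_upwards [h'.coeFn_toLp] with x hx
    rw [hx]
  change ∫ x, deriv φ x • (h.toLp : ℝ → C2) x = -∫ x, φ x • (h'.toLp : ℝ → C2) x
  have i1 : Integrable (fun x => φ x • u' x) volume :=
    (hφ.continuous.smul hc').integrable_of_hasCompactSupport hc.smul_right
  have i2 : Integrable (fun x => deriv φ x • u x) volume :=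
    (hd.smul hcu).integrable_of_hasCompactSupport hc.deriv.smul_right
  have i3 : Integrable (fun x => φ x • u x) volume :=
    (hφ.continuous.smul hcu).integrable_of_hasCompactSupport hc.smul_right
  have h0 := integral_eq_zero_of_hasDerivAt_of_integrable
    (fun x => ((hφ.differentiable (by simp)) x).hasDerivAt.smul (hu x)) (i1.add i2) i3
  have h1 := integral_add i1 i2
  rw [e1, e2, eq_neg_iff_add_eq_zero, add_comm, ← h1]
  exact h0

/-- The cut-off `(1 + a² x²)⁻¹`. -/
def cutoff (a x : ℝ) : ℝ := (1 + (a * x) ^ 2)⁻¹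

theorem cutoff_pos (a x : ℝ) : 0 < cutoff a x := by unfold cutoff; positivity

theorem memLp_cutoff {a : ℝ} (ha : 0 < a) : MemLp (cutoff a) 2 volume := by
  have hcont : Continuous (cutoff a) := by
    unfold cutoff
    exact Continuous.inv₀ (by fun_prop) fun x => by positivity
  rw [memLp_two_iff_integrable_sq_norm hcont.aestronglyMeasurable]
  refine (integrable_inv_one_add_sq.comp_mul_left' ha.ne').mono'
    (hcont.norm.pow 2).aestronglyMeasurable (Filter.Eventually.of_forall fun x => ?_)
  have h1 : cutoff a x ≤ 1 := inv_le_one_of_one_le₀ (by nlinarith [sq_nonneg (a * x)])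
  have h0 := cutoff_pos a x
  rw [norm_pow, norm_norm, Real.norm_of_nonneg h0.le]
  change cutoff a x ^ 2 ≤ cutoff a x
  nlinarith

/-- By 2a|x| ≤ 1 + a²x² the derivative is pointwise at most a times the cut-off itself. Errors are
thus compared directly with the trial function, without computing L² norms. -/
theorem exists_hasDerivAt_cutoff {a : ℝ} (ha : 0 < a) : ∃ d : ℝ → ℝ, Continuous d ∧
    (∀ x, HasDerivAt (cutoff a) (d x) x) ∧ ∀ x, |d x| ≤ a * cutoff a x := by
  refine ⟨fun x => -(2 * a ^ 2 * x) / (1 + (a * x) ^ 2) ^ 2, ?_, fun x => ?_, fun x => ?_⟩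
  · exact Continuous.div (by fun_prop) (by fun_prop) fun x => by positivity
  · have h1 : HasDerivAt (fun x : ℝ => 1 + (a * x) ^ 2) (2 * a ^ 2 * x) x := by
      have := ((((hasDerivAt_id x).const_mul a).pow 2).const_add 1)
      refine this.congr_deriv ?_
      simp
      ring
    exact h1.inv (by positivity)
  · have hp : 0 < 1 + (a * x) ^ 2 := by positivity
    rw [abs_div, abs_neg, abs_of_pos (pow_pos hp 2), cutoff, div_le_iff₀ (pow_pos hp 2)]
    have : a * (1 + (a * x) ^ 2)⁻¹ * (1 + (a * x) ^ 2) ^ 2 = a * (1 + (a * x) ^ 2) := by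
      field_simp
    rw [this, abs_mul, abs_of_pos (by positivity : 0 < 2 * a ^ 2)]
    rw [mul_pow, ← sq_abs x]
    nlinarith [mul_nonneg ha.le (sq_nonneg (a * |x| - 1))]

/-- An eigenvector of the symbol κσ₁ + mσ₃ for z. The choice (κ, z − m) vanishes only when κ = 0 and
z = m, where (1, 0) serves. -/
theorem exists_plane_wave_vector (m : ℝ) (κ : ℝ) (z : ℂ) (h : z ^ 2 - (m : ℂ) ^ 2 = (κ : ℂ) ^ 2) :
    ∃ v : C2, v ≠ 0 ∧ matOp ((-Complex.I) • sigma1) ((Complex.I * κ) • v) +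
      matOp ((m : ℂ) • sigma3) v = z • v := by
  have hI := Complex.I_sq
  by_cases h0 : (κ : ℂ) = 0 ∧ z = m
  · refine ⟨WithLp.toLp 2 ![1, 0], fun h => ?_, ?_⟩
    · have := congrArg (fun u : C2 => u 0) h
      simp at this
    · rw [h0.1, h0.2]
      ext i
      fin_cases i <;> simp [matOp_apply, sigma1, sigma3]
  · refine ⟨WithLp.toLp 2 ![(κ : ℂ), z - m], fun h => h0 ?_, ?_⟩
    · have h1 := congrArg (fun u : C2 => u 0) h
      have h2 := congrArg (fun u : C2 => u 1) h
      simp only [Matrix.cons_val_zero, Matrix.cons_val_one, PiLp.zero_apply, Matrix.cons_val_fin_one] at h1 h2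
      exact ⟨h1, sub_eq_zero.1 h2⟩
    · ext i
      fin_cases i
      · simp [matOp_apply, sigma1, sigma3]
        linear_combination (-κ * (z - m)) * hI
      · simp [matOp_apply, sigma1, sigma3]
        linear_combination (-(κ : ℂ) ^ 2) * hI - h

/-- Slowly cut off plane waves u satisfy ‖(H₀ − z)u‖ ≤ Ca‖u‖ with a arbitrarily small, which no
bounded inverse permits. -/
theorem not_mem_resolventSet_freeDirac {m κ : ℝ} {z : ℂ}
    (h : z ^ 2 - (m : ℂ) ^ 2 = (κ : ℂ) ^ 2) : z ∉ resolventSet (freeDirac m) := by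
  rintro ⟨R, hR⟩
  obtain ⟨v, hv, hvz⟩ := exists_plane_wave_vector m κ z h
  set C := ‖matOp ((-Complex.I) • sigma1)‖ with hC
  -- Chosen so that ‖R‖Ca < 1, which contradicts ‖u‖ ≤ ‖R‖Ca‖u‖.
  set a : ℝ := (‖R‖ * C + 1)⁻¹ with ha'
  have hq : 0 < ‖R‖ * C + 1 := by positivity
  have ha : 0 < a := inv_pos.2 hq
  obtain ⟨d, hdc, hd, hdb⟩ := exists_hasDerivAt_cutoff ha
  set e : ℝ → ℂ := fun x => Complex.exp (Complex.I * κ * x) with he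
  have hen : ∀ x, ‖e x‖ = 1 := fun x => by
    simp only [he, Complex.norm_exp]
    simp
  have hec : Continuous e := by fun_prop
  have hed : ∀ x, HasDerivAt e (Complex.I * κ * e x) x := fun x => by
    have h2 : HasDerivAt (fun x : ℝ => Complex.I * κ * (x : ℂ)) (Complex.I * κ) x := by
      simpa using ((hasDerivAt_id x).ofReal_comp).const_mul (Complex.I * (κ : ℂ))
    simpa [he, mul_comm] using h2.cexp
  set u : ℝ → C2 := fun x => cutoff a x • e x • v with hu
  set u' : ℝ → C2 := fun x => cutoff a x • (Complex.I * κ * e x) • v + d x • e x • v with hu'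
  have hcc : Continuous (cutoff a) := continuous_iff_continuousAt.2 fun x => (hd x).continuousAt
  have huc : Continuous u := hcc.smul (hec.smul continuous_const)
  have huc' : Continuous u' := by
    exact (hcc.smul ((continuous_const.mul hec).smul continuous_const)).add
      (hdc.smul (hec.smul continuous_const))
  have hder : ∀ x, HasDerivAt u (u' x) x := fun x => (hd x).smul ((hed x).smul_const v)
  have mu : MemLp u 2 volume := by
    refine ((memLp_cutoff ha).const_mul ‖v‖).of_le huc.aestronglyMeasurable
      (Filter.Eventually.of_forall fun x => le_of_eq ?_)
    simp only [hu, norm_smul, norm_mul, hen, norm_norm, one_mul, mul_comm]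
  have mu' : MemLp u' 2 volume := by
    refine ((memLp_cutoff ha).const_mul ((|κ| + a) * ‖v‖)).of_le huc'.aestronglyMeasurable
      (Filter.Eventually.of_forall fun x => ?_)
    refine (norm_add_le _ _).trans ?_
    have h0 := cutoff_pos a x
    simp only [norm_smul, norm_mul, hen, Complex.norm_I, Complex.norm_real, Real.norm_eq_abs,
      abs_of_pos h0, mul_one, one_mul, abs_norm]
    rw [abs_of_nonneg (by positivity : 0 ≤ |κ| + a)]
    nlinarith [mul_le_mul_of_nonneg_right (hdb x) (norm_nonneg v)]
  obtain ⟨hdom, hval⟩ := freeDirac_apply_of_mem (m := m)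
    (mem_weakDerivGraph_of_hasDerivAt hder huc' mu mu')
  have hR2 := hR.2 ⟨_, hdom⟩
  rw [hval] at hR2
  have hle : ‖constMat ((-Complex.I) • sigma1) mu'.toLp + constMat ((m : ℂ) • sigma3) mu.toLp -
      z • mu.toLp‖ ≤ C * a * ‖mu.toLp‖ := by
    refine Lp.norm_le_mul_norm_of_ae_le_mul ?_
    filter_upwards [coeFn_constMat_add ((-Complex.I) • sigma1) ((m : ℂ) • sigma3) mu.toLp mu'.toLp,
      Lp.coeFn_sub (constMat ((-Complex.I) • sigma1) mu'.toLp +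
        constMat ((m : ℂ) • sigma3) mu.toLp) (z • mu.toLp), Lp.coeFn_smul z mu.toLp,
      mu.coeFn_toLp, mu'.coeFn_toLp] with x h1 h2 h3 h4 h5
    rw [h2, Pi.sub_apply, h1, h3, Pi.smul_apply, h4, h5]
    have e3 : matOp ((-Complex.I) • sigma1) (u' x) + matOp ((m : ℂ) • sigma3) (u x) - z • u x =
        d x • e x • matOp ((-Complex.I) • sigma1) v := by
      have e4 : u' x = (cutoff a x * e x) • ((Complex.I * κ) • v) + ((d x : ℂ) * e x) • v := by
        simp only [hu']
        module
      have e5 : u x = (cutoff a x * e x) • v := by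
        simp only [hu]
        module
      rw [e4, e5]
      simp only [map_add, map_smul] at hvz ⊢
      linear_combination (norm := module) ((cutoff a x : ℂ) * e x) • hvz
    rw [e3]
    simp only [norm_smul, hen, one_mul, hu, Real.norm_eq_abs, abs_of_pos (cutoff_pos a x)]
    calc |d x| * ‖matOp ((-Complex.I) • sigma1) v‖ ≤ (a * cutoff a x) * (C * ‖v‖) :=
          mul_le_mul (hdb x) (ContinuousLinearMap.le_opNorm _ _) (norm_nonneg _)
            (mul_nonneg ha.le (cutoff_pos a x).le)
      _ = _ := by ring
  have h6 : ‖mu.toLp‖ ≤ ‖R‖ * (C * a * ‖mu.toLp‖) := by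
    calc ‖mu.toLp‖ = ‖R (constMat ((-Complex.I) • sigma1) mu'.toLp +
          constMat ((m : ℂ) • sigma3) mu.toLp - z • mu.toLp)‖ := congrArg norm hR2.symm
      _ ≤ _ := (R.le_opNorm _).trans (by gcongr)
  have hpos : 0 < ‖mu.toLp‖ := by
    rw [norm_pos_iff]
    intro h0
    rw [Lp.eq_zero_iff_ae_eq_zero] at h0
    have h7 := mu.coeFn_toLp.symm.trans h0
    obtain ⟨x, hx⟩ := h7.exists
    have : u x ≠ 0 := by
      simp only [hu]
      refine smul_ne_zero (cutoff_pos a x).ne' (smul_ne_zero ?_ hv)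
      exact Complex.exp_ne_zero _
    exact this hx
  have h8 : ‖R‖ * C * a < 1 := by
    rw [ha', ← div_eq_mul_inv, div_lt_one hq]
    linarith
  nlinarith

theorem spectrum_freeDirac_nonempty (m : ℝ) : (spectrum (freeDirac m)).Nonempty :=
  ⟨m, not_mem_resolventSet_freeDirac (κ := 0) (by simp)⟩

/-- Points of `ρ(H₀)` lie off the cut of `√(z² - m²)`. -/
theorem upperSqrt_im_pos_of_mem_resolventSet {m : ℝ} {z : ℂ} (hz : z ∈ resolventSet (freeDirac m)) :
    0 < (upperSqrt (z ^ 2 - (m : ℂ) ^ 2)).im := by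
  refine upperSqrt_im_pos ?_
  rintro ⟨h1, h2⟩
  refine not_mem_resolventSet_freeDirac (κ := √(z ^ 2 - (m : ℂ) ^ 2).re) ?_ hz
  have h3 : ((√(z ^ 2 - (m : ℂ) ^ 2).re : ℝ) : ℂ) ^ 2 = ((z ^ 2 - (m : ℂ) ^ 2).re : ℂ) := by
    exact_mod_cast congrArg Complex.ofReal (Real.sq_sqrt h1)
  rw [h3]
  exact Complex.ext rfl (by simpa using h2)

end EssentialSpectrum

/-! ### Maximal multiplication operators. -/

section MultiplicationOperators

theorem mem_mulOp_domain {M : ℝ → Mat2} {f : Hil} :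
    f ∈ (mulOp M).domain ↔ MemLp (fun t => matOp (M t) (f t)) 2 volume := Iff.rfl

theorem coeFn_mulOp {M : ℝ → Mat2} (f : (mulOp M).domain) :
    (mulOp M f : Hil) =ᵐ[volume] fun t => matOp (M t) ((f : Hil) t) :=
  MemLp.coeFn_toLp (mem_mulOp_domain.1 f.2)

theorem norm_mulOp_eq {M : ℝ → Mat2} (f : (mulOp M).domain) :
    ‖mulOp M f‖ = (eLpNorm (fun t => matOp (M t) ((f : Hil) t)) 2 volume).toReal :=
  Lp.norm_toLp _ (mem_mulOp_domain.1 f.2)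

/-- If g is orthogonal to the domain, test it against its own truncation to {‖M‖ ≤ n}, which lies in
the domain: g vanishes on each of these sets, and they exhaust the line. -/
theorem dense_mulOp_domain {M : ℝ → Mat2} (hM : EntryMeas M) :
    Dense ((mulOp M).domain : Set Hil) := by
  rw [Submodule.dense_iff_topologicalClosure_eq_top, Submodule.topologicalClosure_eq_top_iff,
    Submodule.eq_bot_iff]
  intro g hg
  rw [Submodule.mem_orthogonal'] at hg
  obtain ⟨N, hNm, hN⟩ := hM.aestronglyMeasurable_matOp
  have hS : ∀ n : ℕ, MeasurableSet {t | ‖N t‖ ≤ n} := fun n =>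
    measurableSet_le hNm.norm.measurable measurable_const
  have key : ∀ n : ℕ, ∀ᵐ t, ‖N t‖ ≤ n → g t = 0 := by
    intro n
    have hmem := (Lp.memLp g).indicator (hS n)
    have hdom : hmem.toLp ∈ (mulOp M).domain := by
      rw [mem_mulOp_domain]
      refine ((Lp.memLp g).norm.const_mul (n : ℝ)).of_le
        (hM.aestronglyMeasurable_apply (Lp.memLp hmem.toLp).1) ?_
      filter_upwards [hmem.coeFn_toLp, hN] with t h1 h2
      rw [h1, h2, norm_mul, norm_norm, Real.norm_natCast]
      by_cases ht : t ∈ {t | ‖N t‖ ≤ n}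
      · rw [Set.indicator_of_mem ht]
        exact (N t).le_of_opNorm_le ht _
      · rw [Set.indicator_of_notMem ht, map_zero, norm_zero]
        positivity
    have h0 := hg _ hdom
    rw [L2.inner_def] at h0
    have e1 : ∀ᵐ t, inner ℂ (g t) ((hmem.toLp : ℝ → C2) t) =
        (({t | ‖N t‖ ≤ n}.indicator (fun t => ‖g t‖ ^ 2) t : ℝ) : ℂ) := by
      filter_upwards [hmem.coeFn_toLp] with t h1
      rw [h1]
      by_cases ht : t ∈ {t | ‖N t‖ ≤ n}
      · rw [Set.indicator_of_mem ht, Set.indicator_of_mem ht, inner_self_eq_norm_sq_to_K]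
        simp
      · rw [Set.indicator_of_notMem ht, Set.indicator_of_notMem ht]
        simp
    rw [integral_congr_ae e1, integral_complex_ofReal] at h0
    have h2 : ∫ t, {t | ‖N t‖ ≤ n}.indicator (fun t => ‖g t‖ ^ 2) t = 0 := by exact_mod_cast h0
    have hint := ((memLp_two_iff_integrable_sq_norm (Lp.memLp g).1).1 (Lp.memLp g)).indicator (hS n)
    rw [integral_eq_zero_iff_of_nonneg (fun t => Set.indicator_nonneg (fun _ _ => sq_nonneg _) _)
      hint] at h2
    filter_upwards [h2] with t h3 ht
    rw [Set.indicator_of_mem (show t ∈ {t | ‖N t‖ ≤ n} from ht)] at h3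
    simpa using h3
  rw [← ae_all_iff] at key
  rw [Lp.eq_zero_iff_ae_eq_zero]
  filter_upwards [key] with t ht
  obtain ⟨n, hn⟩ := exists_nat_ge ‖N t‖
  exact ht n hn

end MultiplicationOperators

/-! ### Mapping bounds for the kernel operator and for the factors of V. -/

section Splittings

/-- `g` is the sum of an `L¹` function of norm at most `a` and an `L²` function of norm
at most `b`. -/
def IsL1AddL2 (g : ℝ → C2) (a b : ℝ) : Prop :=
  ∃ g₁ g₂ : ℝ → C2, (g =ᵐ[volume] g₁ + g₂) ∧ Integrable g₁ volume ∧ MemLp g₂ 2 volume ∧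
    ∫ t, ‖g₁ t‖ ≤ a ∧ (eLpNorm g₂ 2 volume).toReal ≤ b

/-- `f` is bounded by `s` and has `L²` norm at most `τ`. -/
def IsLinfL2 (f : Hil) (s τ : ℝ) : Prop := (∀ᵐ t, ‖f t‖ ≤ s) ∧ ‖f‖ ≤ τ

/-- Operator norm bounds of a kernel operator between `L¹`, `L²` and `L^∞`. -/
structure KernelBounds (F : ℝ → C2 →L[ℂ] C2) (η β d : ℝ) : Prop where
  isKernel : IsKernel F
  nonneg : 0 ≤ d
  sup_le : ∀ t, ‖F t‖ ≤ η
  two_le : (eLpNorm F 2 volume).toReal ≤ β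
  norm_le : ∀ f, ‖convOp isKernel f‖ ≤ d * ‖f‖

variable {F : ℝ → C2 →L[ℂ] C2} {η β d : ℝ}

theorem KernelBounds.eta_nonneg (h : KernelBounds F η β d) : 0 ≤ η :=
  (norm_nonneg _).trans (h.sup_le 0)

theorem KernelBounds.beta_nonneg (h : KernelBounds F η β d) : 0 ≤ β :=
  ENNReal.toReal_nonneg.trans h.two_le

theorem IsL1AddL2.integrable_kernel (h : KernelBounds F η β d) {g : ℝ → C2} {a b : ℝ}
    (hg : IsL1AddL2 g a b) (x : ℝ) : Integrable (fun y => F (x - y) (g y)) volume := by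
  obtain ⟨g₁, g₂, he, h1, h2, -, -⟩ := hg
  refine ((integrable_kernel_of_integrable h.isKernel.1.1 h.sup_le h1 x).add
    (integrable_kernel_of_memLp h.isKernel.2 h2 x)).congr ?_
  filter_upwards [he] with y hy
  rw [hy, Pi.add_apply, Pi.add_apply, map_add]

/-- The four operator bounds η, β, β, d, one for each pair of source space (L¹, L²) and target space
(L^∞, L²). -/
theorem IsL1AddL2.convK (h : KernelBounds F η β d) {g : ℝ → C2} {a b : ℝ}
    (hg : IsL1AddL2 g a b) : MemLp (convK F g) 2 volume ∧
      (∀ x, ‖convK F g x‖ ≤ η * a + β * b) ∧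
      (eLpNorm (DiracSpec.convK F g) 2 volume).toReal ≤ β * a + d * b := by
  obtain ⟨g₁, g₂, he, h1, h2, ha, hb⟩ := hg
  have hη := h.eta_nonneg
  have hβ := h.beta_nonneg
  have hd := h.nonneg
  have hsum : DiracSpec.convK F g = DiracSpec.convK F g₁ + DiracSpec.convK F g₂ := by
    funext x
    rw [convK_congr he x, Pi.add_apply]
    simp only [DiracSpec.convK, Pi.add_apply, map_add]
    exact integral_add (integrable_kernel_of_integrable h.isKernel.1.1 h.sup_le h1 x)
      (integrable_kernel_of_memLp h.isKernel.2 h2 x)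
  have m1 := memLp_convK_of_integrable h.isKernel.2 h1
  have m2 := memLp_convK_of_memLp h.isKernel.1 h2
  refine ⟨hsum ▸ m1.add m2, fun x => ?_, ?_⟩
  · rw [hsum, Pi.add_apply]
    refine (norm_add_le _ _).trans (add_le_add ?_ ?_)
    · exact (norm_convK_le_of_integrable h.sup_le h1 x).trans (by gcongr)
    · exact (norm_convK_le_of_memLp h.isKernel.2 h2 x).trans
        (mul_le_mul h.two_le hb ENNReal.toReal_nonneg hβ)
  · rw [hsum]
    refine (ENNReal.toReal_mono (ENNReal.add_lt_top.2 ⟨m1.2, m2.2⟩).ne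
      (eLpNorm_add_le m1.1 m2.1 (by norm_num))).trans ?_
    rw [ENNReal.toReal_add m1.2.ne m2.2.ne]
    refine add_le_add ?_ ?_
    · have := ENNReal.toReal_mono (ENNReal.mul_lt_top h.isKernel.2.2
        (memLp_one_iff_integrable.2 h1).2).ne (eLpNorm_convK_le_of_integrable h.isKernel.2 h1)
      rw [ENNReal.toReal_mul, eLpNorm_one_eq_lintegral_enorm,
        ← integral_norm_eq_lintegral_enorm h1.1] at this
      exact this.trans (mul_le_mul h.two_le ha (by positivity) hβ)
    · have h3 := h.norm_le h2.toLp
      have h4 : ‖convOp h.isKernel h2.toLp‖ = (eLpNorm (DiracSpec.convK F g₂) 2 volume).toReal := by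
        rw [Lp.norm_def]
        congr 1
        refine eLpNorm_congr_ae ((coeFn_convOp _ _).trans ?_)
        exact Filter.Eventually.of_forall fun x => convK_congr h2.coeFn_toLp x
      rw [h4, Lp.norm_toLp] at h3
      exact h3.trans (by gcongr)

/-- An admissible decomposition `V = W + X`. -/
structure IsSplitting (V W X : ℝ → Mat2) (ε c : ℝ) : Prop where
  pos : 0 < ε
  measV : EntryMeas V
  eq : ∀ᵐ t, V t = W t + X t
  integrableW : ∀ i j, Integrable (fun t => W t i j) volume
  measX : ∀ i j, AEStronglyMeasurable (fun t => X t i j) volume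
  le : ∀ᵐ t, ‖matOp (X t)‖ ≤ ε
  cost : ∫ t, ‖matOp (W t)‖ = c

variable {V W X : ℝ → Mat2} {ε c : ℝ}

theorem integrable_norm_matOp (hW : ∀ i j, Integrable (fun t => W t i j) volume) :
    Integrable (fun t => matOp (W t)) volume := by
  refine Integrable.mono' ((((hW 0 0).norm.add (hW 0 1).norm).add (hW 1 0).norm).add (hW 1 1).norm)
    (EntryMeas.aestronglyMeasurable_matOp fun i j => (hW i j).1.aemeasurable) ?_
  exact Filter.Eventually.of_forall fun t => norm_matOp_le_sum _

theorem IsSplitting.cost_nonneg (h : IsSplitting V W X ε c) : 0 ≤ c := by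
  rw [← h.cost]; positivity

theorem IsSplitting.norm_le (h : IsSplitting V W X ε c) :
    ∀ᵐ t, ‖matOp (V t)‖ ≤ ‖matOp (W t)‖ + ε := by
  filter_upwards [h.eq, h.le] with t h1 h2
  rw [h1, matOp_add]
  exact (norm_add_le _ _).trans (by gcongr)

theorem IsSplitting.isL1AddL2_apply (h : IsSplitting V W X ε c) {f : Hil} {s τ : ℝ}
    (hf : IsLinfL2 f s τ) : IsL1AddL2 (fun t => matOp (V t) (f t)) (c * s) (ε * τ) := by
  have hε := h.pos
  have iW := integrable_norm_matOp h.integrableW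
  have mW : EntryMeas W := fun i j => (h.integrableW i j).1.aemeasurable
  have mX : EntryMeas X := fun i j => (h.measX i j).aemeasurable
  have b1 : ∀ᵐ t, ‖matOp (W t) (f t)‖ ≤ ‖matOp (W t)‖ * s := by
    filter_upwards [hf.1] with t ht
    exact (matOp (W t)).le_opNorm_of_le ht
  have b2 : ∀ᵐ t, ‖matOp (X t) (f t)‖ ≤ ε * ‖f t‖ := by
    filter_upwards [h.le] with t ht
    exact (matOp (X t)).le_of_opNorm_le ht _
  have i1 : Integrable (fun t => matOp (W t) (f t)) volume :=
    (iW.norm.mul_const s).mono' (mW.aestronglyMeasurable_apply (Lp.memLp f).1) b1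
  refine ⟨fun t => matOp (W t) (f t), fun t => matOp (X t) (f t), ?_, i1, ?_, ?_, ?_⟩
  · filter_upwards [h.eq] with t ht
    rw [ht, matOp_add]
    rfl
  · exact (Lp.memLp f).of_le_mul (mX.aestronglyMeasurable_apply (Lp.memLp f).1) b2
  · rw [← h.cost, ← integral_mul_const]
    exact integral_mono_ae i1.norm (iW.norm.mul_const s) b1
  · have h3 := eLpNorm_le_mul_eLpNorm_of_ae_le_mul b2 2
    have h4 := ENNReal.toReal_mono (ENNReal.mul_lt_top ENNReal.ofReal_lt_top (Lp.memLp f).2).ne h3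
    rw [ENNReal.toReal_mul, ENNReal.toReal_ofReal hε.le, ← Lp.norm_def] at h4
    exact h4.trans (mul_le_mul_of_nonneg_left hf.2 hε.le)

/-- Integrating ‖|V|^{1/2}f‖² ≤ (‖W‖ + ε)|f|² gives cs² + ετ², which is at most (√c s + √ε τ)². -/
theorem IsSplitting.memLp_matAbsSqrt (h : IsSplitting V W X ε c) {f : Hil} {s τ : ℝ}
    (hf : IsLinfL2 f s τ) : f ∈ (mulOp fun t => matAbsSqrt (V t)).domain ∧
      (eLpNorm (fun t => matOp (matAbsSqrt (V t)) (f t)) 2 volume).toReal ≤ √c * s + √ε * τ := by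
  have hε := h.pos
  have hs : 0 ≤ s := by
    obtain ⟨t, ht⟩ := hf.1.exists
    exact (norm_nonneg _).trans ht
  have hτ : 0 ≤ τ := (norm_nonneg _).trans hf.2
  have iW := integrable_norm_matOp h.integrableW
  have if2 := (memLp_two_iff_integrable_sq_norm (Lp.memLp f).1).1 (Lp.memLp f)
  have b : ∀ᵐ t, ‖matOp (matAbsSqrt (V t)) (f t)‖ ^ 2 ≤
      ‖matOp (W t)‖ * s ^ 2 + ε * ‖f t‖ ^ 2 := by
    filter_upwards [hf.1, h.norm_le] with t h1 h2
    calc ‖matOp (matAbsSqrt (V t)) (f t)‖ ^ 2 ≤ (‖matOp (matAbsSqrt (V t))‖ * ‖f t‖) ^ 2 := by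
          gcongr; exact ContinuousLinearMap.le_opNorm _ _
      _ = ‖matOp (V t)‖ * ‖f t‖ ^ 2 := by rw [mul_pow, norm_matOp_matAbsSqrt_sq]
      _ ≤ (‖matOp (W t)‖ + ε) * ‖f t‖ ^ 2 := by gcongr
      _ = ‖matOp (W t)‖ * ‖f t‖ ^ 2 + ε * ‖f t‖ ^ 2 := by ring
      _ ≤ _ := by gcongr
  have hm := h.measV.matAbsSqrt.aestronglyMeasurable_apply (Lp.memLp f).1
  have ib : Integrable (fun t => ‖matOp (W t)‖ * s ^ 2 + ε * ‖f t‖ ^ 2) volume :=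
    (iW.norm.mul_const _).add (if2.const_mul ε)
  have mem : MemLp (fun t => matOp (matAbsSqrt (V t)) (f t)) 2 volume := by
    rw [memLp_two_iff_integrable_sq_norm hm]
    refine ib.mono' (hm.norm.pow 2) ?_
    filter_upwards [b] with t ht
    rwa [norm_pow, norm_norm]
  refine ⟨mem, ?_⟩
  have h5 := toReal_eLpNorm_two_sq mem
  have h6 := integral_mono_ae ((memLp_two_iff_integrable_sq_norm hm).1 mem) ib b
  rw [integral_add (iW.norm.mul_const _) (if2.const_mul ε), integral_mul_const, integral_const_mul,
    h.cost, ← toReal_eLpNorm_two_sq (Lp.memLp f), ← Lp.norm_def, ← h5] at h6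
  have h7 : ε * ‖f‖ ^ 2 ≤ ε * τ ^ 2 := by
    have := hf.2
    gcongr
  have hc := h.cost_nonneg
  refine le_of_sq_le_sq ?_ (by positivity)
  nlinarith [Real.sq_sqrt hc, Real.sq_sqrt hε.le, mul_nonneg (mul_nonneg (Real.sqrt_nonneg c) hs)
    (mul_nonneg (Real.sqrt_nonneg ε) hτ)]

/-- The splitting V = W + X does not split B = U|V|^{1/2}. Instead Bu is divided by the scalar
weights w/(w + ε) and ε/(w + ε), w = ‖W‖: since |Bu|² ≤ (w + ε)|u|², the two parts are at most √w
|u| and √ε |u|. -/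
theorem IsSplitting.isL1AddL2_matPolar (h : IsSplitting V W X ε c) (u : Hil) :
    IsL1AddL2 (fun t => matOp (matPolar (V t) * matAbsSqrt (V t)) (u t)) (√c * ‖u‖) (√ε * ‖u‖) := by
  have hε := h.pos
  have iW := integrable_norm_matOp h.integrableW
  have hm := (h.measV.matPolar.mul h.measV.matAbsSqrt).aestronglyMeasurable_apply (Lp.memLp u).1
  set g := fun t => matOp (matPolar (V t) * matAbsSqrt (V t)) (u t) with hg
  set w := fun t => ‖matOp (W t)‖ with hw
  have hw0 : ∀ t, 0 ≤ w t := fun t => norm_nonneg _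
  have hwm : AEMeasurable w volume := iW.1.norm.aemeasurable
  have hgb : ∀ᵐ t, ‖g t‖ ^ 2 ≤ (w t + ε) * ‖u t‖ ^ 2 := by
    filter_upwards [h.norm_le] with t ht
    calc ‖g t‖ ^ 2 ≤ (‖matOp (matPolar (V t) * matAbsSqrt (V t))‖ * ‖u t‖) ^ 2 := by
          gcongr; exact ContinuousLinearMap.le_opNorm _ _
      _ = ‖matOp (V t)‖ * ‖u t‖ ^ 2 := by rw [mul_pow, norm_matOp_matPolar_mul_sq]
      _ ≤ _ := by gcongr
  have b1 : ∀ᵐ t, ‖(w t / (w t + ε)) • g t‖ ^ 2 ≤ w t * ‖u t‖ ^ 2 := by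
    filter_upwards [hgb] with t ht
    have h1 : 0 < w t + ε := by linarith [hw0 t]
    rw [norm_smul, mul_pow, Real.norm_of_nonneg (div_nonneg (hw0 t) h1.le)]
    calc (w t / (w t + ε)) ^ 2 * ‖g t‖ ^ 2 ≤ (w t / (w t + ε)) ^ 2 * ((w t + ε) * ‖u t‖ ^ 2) := by
          gcongr
      _ = (w t / (w t + ε)) * (w t * ‖u t‖ ^ 2) := by field_simp
      _ ≤ 1 * (w t * ‖u t‖ ^ 2) := by
          have := hw0 t
          gcongr
          rw [div_le_one h1]; linarith
      _ = _ := one_mul _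
  have b2 : ∀ᵐ t, ‖(ε / (w t + ε)) • g t‖ ≤ √ε * ‖u t‖ := by
    filter_upwards [hgb] with t ht
    have h1 : 0 < w t + ε := by linarith [hw0 t]
    refine le_of_sq_le_sq ?_ (by positivity)
    rw [norm_smul, mul_pow, mul_pow, Real.sq_sqrt hε.le, Real.norm_of_nonneg (by positivity)]
    calc (ε / (w t + ε)) ^ 2 * ‖g t‖ ^ 2 ≤ (ε / (w t + ε)) ^ 2 * ((w t + ε) * ‖u t‖ ^ 2) := by
          gcongr
      _ = (ε / (w t + ε)) * (ε * ‖u t‖ ^ 2) := by field_simp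
      _ ≤ 1 * (ε * ‖u t‖ ^ 2) := by
          gcongr
          rw [div_le_one h1]; linarith [hw0 t]
      _ = _ := one_mul _
  have m1 : AEStronglyMeasurable (fun t => (w t / (w t + ε)) • g t) volume :=
    (hwm.div (hwm.add_const ε)).aestronglyMeasurable.smul hm
  have m2 : AEStronglyMeasurable (fun t => (ε / (w t + ε)) • g t) volume :=
    ((hwm.add_const ε).const_div ε).aestronglyMeasurable.smul hm
  have c1 : ∀ᵐ t, ‖(w t / (w t + ε)) • g t‖ ≤ √(w t) * ‖u t‖ := by
    filter_upwards [b1] with t ht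
    refine le_of_sq_le_sq ?_ (by positivity)
    rwa [mul_pow, Real.sq_sqrt (hw0 t)]
  have msq : MemLp (fun t => √(w t)) 2 volume := by
    rw [memLp_two_iff_integrable_sq hwm.sqrt.aestronglyMeasurable]
    refine iW.norm.congr (Filter.Eventually.of_forall fun t => ?_)
    simp only [Real.sq_sqrt (hw0 t)]
    rfl
  have iprod : Integrable (fun t => √(w t) * ‖u t‖) volume :=
    msq.integrable_mul (Lp.memLp u).norm
  have i1 : Integrable (fun t => (w t / (w t + ε)) • g t) volume := iprod.mono' m1 c1
  refine ⟨fun t => (w t / (w t + ε)) • g t, fun t => (ε / (w t + ε)) • g t, ?_, i1, ?_, ?_, ?_⟩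
  · refine Filter.Eventually.of_forall fun t => ?_
    have h1 : w t + ε ≠ 0 := by linarith [hw0 t]
    rw [Pi.add_apply, ← add_smul, ← add_div, div_self h1, one_smul]
  · exact (Lp.memLp u).of_le_mul m2 b2
  · refine (integral_mono_ae i1.norm iprod c1).trans ?_
    have hC := integral_mul_le_Lp_mul_Lq_of_nonneg (μ := (volume : Measure ℝ))
      (Real.HolderConjugate.two_two) (f := fun t => √(w t)) (g := fun t => ‖u t‖)
      (Filter.Eventually.of_forall fun t => Real.sqrt_nonneg _)
      (Filter.Eventually.of_forall fun t => norm_nonneg _) (by simpa using msq)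
      (by simpa using (Lp.memLp u).norm)
    refine hC.trans (le_of_eq ?_)
    simp only [Real.rpow_two, Real.sq_sqrt (hw0 _)]
    rw [← Real.sqrt_eq_rpow, ← Real.sqrt_eq_rpow, ← toReal_eLpNorm_two_sq (Lp.memLp u),
      ← Lp.norm_def, Real.sqrt_sq (norm_nonneg _)]
    congr 2
    exact h.cost
  · have h3 := eLpNorm_le_mul_eLpNorm_of_ae_le_mul b2 2
    have h4 := ENNReal.toReal_mono (ENNReal.mul_lt_top ENNReal.ofReal_lt_top (Lp.memLp u).2).ne h3
    rwa [ENNReal.toReal_mul, ENNReal.toReal_ofReal (Real.sqrt_nonneg _), ← Lp.norm_def] at h4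

end Splittings

/-! ### The sandwiched resolvent Q(z) and invertibility of I + Q(z). -/

section SandwichedResolvent

variable {F : ℝ → C2 →L[ℂ] C2} {η β d : ℝ} {V W X : ℝ → Mat2} {ε c : ℝ}

/-- The closure of `R₀(z) B`, where `R₀(z)` is the kernel operator and `B = U |V|^{1/2}`. -/
def closureRB (h : KernelBounds F η β d) (hs : IsSplitting V W X ε c) : Hil →L[ℂ] Hil :=
  LinearMap.mkContinuous
    { toFun := fun u => ((hs.isL1AddL2_matPolar u).convK h).1.toLp
      map_add' := fun u v => by
        rw [← MemLp.toLp_add, MemLp.toLp_eq_toLp_iff]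
        refine Filter.Eventually.of_forall fun x => ?_
        rw [Pi.add_apply]
        simp only [convK]
        rw [← integral_add ((hs.isL1AddL2_matPolar u).integrable_kernel h x)
          ((hs.isL1AddL2_matPolar v).integrable_kernel h x)]
        refine integral_congr_ae ?_
        filter_upwards [Lp.coeFn_add u v] with y hy
        rw [hy, Pi.add_apply, map_add, map_add]
      map_smul' := fun a u => by
        rw [RingHom.id_apply, ← MemLp.toLp_const_smul, MemLp.toLp_eq_toLp_iff]
        refine Filter.Eventually.of_forall fun x => ?_
        rw [Pi.smul_apply]
        simp only [convK]
        rw [← integral_smul]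
        refine integral_congr_ae ?_
        filter_upwards [Lp.coeFn_smul a u] with y hy
        rw [hy, Pi.smul_apply, map_smul, map_smul] }
    (β * √c + d * √ε) fun u => by
      change ‖((hs.isL1AddL2_matPolar u).convK h).1.toLp‖ ≤ _
      rw [Lp.norm_toLp]
      exact ((hs.isL1AddL2_matPolar u).convK h).2.2.trans (le_of_eq (by ring))

theorem coeFn_closureRB (h : KernelBounds F η β d) (hs : IsSplitting V W X ε c) (u : Hil) :
    closureRB h hs u =ᵐ[volume]
      convK F fun t => matOp (matPolar (V t) * matAbsSqrt (V t)) (u t) :=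
  MemLp.coeFn_toLp ((hs.isL1AddL2_matPolar u).convK h).1

theorem isLinfL2_closureRB_of_isL1AddL2 (h : KernelBounds F η β d) (hs : IsSplitting V W X ε c)
    {u : Hil} {a b : ℝ}
    (hu : IsL1AddL2 (fun t => matOp (matPolar (V t) * matAbsSqrt (V t)) (u t)) a b) :
    IsLinfL2 (closureRB h hs u) (η * a + β * b) (β * a + d * b) := by
  obtain ⟨-, h1, h2⟩ := hu.convK h
  refine ⟨?_, ?_⟩
  · filter_upwards [coeFn_closureRB h hs u] with x hx
    rw [hx]
    exact h1 x
  · rw [Lp.norm_def, eLpNorm_congr_ae (coeFn_closureRB h hs u)]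
    exact h2

theorem isLinfL2_closureRB (h : KernelBounds F η β d) (hs : IsSplitting V W X ε c) (u : Hil) :
    IsLinfL2 (closureRB h hs u) (η * (√c * ‖u‖) + β * (√ε * ‖u‖))
      (β * (√c * ‖u‖) + d * (√ε * ‖u‖)) :=
  isLinfL2_closureRB_of_isL1AddL2 h hs (hs.isL1AddL2_matPolar u)

theorem isLinfL2_convOp (h : KernelBounds F η β d) (f : Hil) :
    IsLinfL2 (convOp h.isKernel f) (β * ‖f‖) (d * ‖f‖) := by
  refine ⟨?_, h.norm_le f⟩
  filter_upwards [coeFn_convOp h.isKernel f] with x hx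
  rw [hx]
  refine (norm_convK_le_of_memLp h.isKernel.2 (Lp.memLp f) x).trans ?_
  rw [← Lp.norm_def]
  gcongr
  exact h.two_le

/-- The operator `A S` for `A = |V|^{1/2}` and a linear operator `S : L² → L² ∩ L^∞`. -/
def matAbsSqrtComp (hs : IsSplitting V W X ε c) (S : Hil →L[ℂ] Hil) (a b : ℝ)
    (hS : ∀ u, IsLinfL2 (S u) (a * ‖u‖) (b * ‖u‖)) : Hil →L[ℂ] Hil :=
  LinearMap.mkContinuous
    { toFun := fun u => mulOp (fun t => matAbsSqrt (V t))
        ⟨S u, (hs.memLp_matAbsSqrt (hS u)).1⟩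
      map_add' := fun u v => by
        rw [← LinearPMap.map_add]
        congr 1
        exact Subtype.ext (map_add S u v)
      map_smul' := fun r u => by
        rw [RingHom.id_apply, ← LinearPMap.map_smul]
        congr 1
        exact Subtype.ext (map_smul S r u) }
    (√c * a + √ε * b) fun u => by
      change ‖mulOp (fun t => matAbsSqrt (V t)) ⟨S u, (hs.memLp_matAbsSqrt (hS u)).1⟩‖ ≤ _
      rw [norm_mulOp_eq]
      exact (hs.memLp_matAbsSqrt (hS u)).2.trans (le_of_eq (by ring))

theorem matAbsSqrtComp_apply (hs : IsSplitting V W X ε c) (S : Hil →L[ℂ] Hil) (a b : ℝ)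
    (hS : ∀ u, IsLinfL2 (S u) (a * ‖u‖) (b * ‖u‖)) (u : Hil) :
    ∃ hd : S u ∈ (mulOp fun t => matAbsSqrt (V t)).domain,
      mulOp (fun t => matAbsSqrt (V t)) ⟨S u, hd⟩ = matAbsSqrtComp hs S a b hS u :=
  ⟨(hs.memLp_matAbsSqrt (hS u)).1, rfl⟩

theorem IsLinfL2.mono {f : Hil} {s τ s' τ' : ℝ} (h : IsLinfL2 f s τ) (h1 : s ≤ s') (h2 : τ ≤ τ') :
    IsLinfL2 f s' τ' :=
  ⟨h.1.mono fun _ ht => ht.trans h1, h.2.trans h2⟩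

theorem isLinfL2_closureRB' (h : KernelBounds F η β d) (hs : IsSplitting V W X ε c) (u : Hil) :
    IsLinfL2 (closureRB h hs u) ((η * √c + β * √ε) * ‖u‖) ((β * √c + d * √ε) * ‖u‖) :=
  (isLinfL2_closureRB h hs u).mono (le_of_eq (by ring)) (le_of_eq (by ring))

/-- The closure `Q(z)` of `A R₀(z) B`. -/
def closureARB (h : KernelBounds F η β d) (hs : IsSplitting V W X ε c) : Hil →L[ℂ] Hil :=
  matAbsSqrtComp hs (closureRB h hs) _ _ (isLinfL2_closureRB' h hs)

/-- One step of the iteration `f ↦ R₀(z) V f`. -/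
theorem isLinfL2_closureRB_mulOp (h : KernelBounds F η β d) (hs : IsSplitting V W X ε c)
    {f : Hil} {s τ : ℝ} (hf : IsLinfL2 f s τ)
    (hd : f ∈ (mulOp fun t => matAbsSqrt (V t)).domain) :
    IsLinfL2 (closureRB h hs (mulOp (fun t => matAbsSqrt (V t)) ⟨f, hd⟩))
      (η * (c * s) + β * (ε * τ)) (β * (c * s) + d * (ε * τ)) := by
  refine isLinfL2_closureRB_of_isL1AddL2 h hs ?_
  obtain ⟨g₁, g₂, he, h1⟩ := hs.isL1AddL2_apply hf
  refine ⟨g₁, g₂, Filter.EventuallyEq.trans ?_ he, h1⟩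
  filter_upwards [coeFn_mulOp (M := fun t => matAbsSqrt (V t)) ⟨f, hd⟩] with t ht
  -- Here B A f = V f pointwise, which brings back the splitting of V itself.
  rw [ht, ← matOp_mul_apply, factorization]

/-- Q^{n+1}u = A fₙ with f₀ = cl(R₀B)u and fₙ₊₁ = R₀V fₙ. The hypotheses say that the row vector (p,
1) times the matrix acting on (s, τ) is at most θ(p, 1), so each step costs a factor θ. -/
theorem closureARB_pow_apply (h : KernelBounds F η β d) (hs : IsSplitting V W X ε c) {p θ : ℝ}
    (hθ : 0 ≤ θ) (h1 : p * (η * c) + β * c ≤ θ * p) (h2 : p * (β * ε) + d * ε ≤ θ)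
    (n : ℕ) (u : Hil) : ∃ (f : Hil) (s τ : ℝ), IsLinfL2 f s τ ∧
      p * s + τ ≤ θ ^ n * ((p * (η * √c + β * √ε) + (β * √c + d * √ε)) * ‖u‖) ∧
      ∃ hd : f ∈ (mulOp fun t => matAbsSqrt (V t)).domain,
        (closureARB h hs ^ (n + 1)) u = mulOp (fun t => matAbsSqrt (V t)) ⟨f, hd⟩ := by
  induction n with
  | zero =>
    refine ⟨_, _, _, isLinfL2_closureRB' h hs u, le_of_eq (by ring),
      (hs.memLp_matAbsSqrt (isLinfL2_closureRB' h hs u)).1, ?_⟩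
    rw [zero_add, pow_one]
    rfl
  | succ n ih =>
    obtain ⟨f, s, τ, hf, hle, hd, he⟩ := ih
    have hf' := isLinfL2_closureRB_mulOp h hs hf hd
    have hs0 : 0 ≤ s := by
      obtain ⟨t, ht⟩ := hf.1.exists
      exact (norm_nonneg _).trans ht
    have hτ0 : 0 ≤ τ := (norm_nonneg _).trans hf.2
    refine ⟨_, _, _, hf', ?_, (hs.memLp_matAbsSqrt hf').1, ?_⟩
    · calc p * (η * (c * s) + β * (ε * τ)) + (β * (c * s) + d * (ε * τ))
          = (p * (η * c) + β * c) * s + (p * (β * ε) + d * ε) * τ := by ring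
        _ ≤ (θ * p) * s + θ * τ := by gcongr
        _ = θ * (p * s + τ) := by ring
        _ ≤ θ * _ := mul_le_mul_of_nonneg_left hle hθ
        _ = _ := by ring
    · rw [pow_succ', mul_apply_eq_comp, he]
      rfl

/-- Some power of −Q has norm less than 1, so 1 − (−Q)^{n+1} is invertible; it is the product of 1 +
Q with a geometric sum commuting with it. -/
theorem isUnit_one_add_of_norm_pow_le {E : Type*} [NormedAddCommGroup E] [NormedSpace ℂ E]
    [CompleteSpace E] {Q : E →L[ℂ] E} {K θ : ℝ} (hθ0 : 0 ≤ θ) (hθ1 : θ < 1)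
    (h : ∀ n, ‖Q ^ (n + 1)‖ ≤ K * θ ^ n) : IsUnit (1 + Q) := by
  have ht : Filter.Tendsto (fun n : ℕ => K * θ ^ n) Filter.atTop (nhds 0) := by
    simpa using (tendsto_pow_atTop_nhds_zero_of_lt_one hθ0 hθ1).const_mul K
  obtain ⟨n, hn⟩ := (ht.eventually (gt_mem_nhds one_pos)).exists
  have h1 : ‖(-Q) ^ (n + 1)‖ < 1 := by
    refine lt_of_le_of_lt ?_ ((h n).trans_lt hn)
    rcases Nat.even_or_odd (n + 1) with he | ho
    · rw [he.neg_pow]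
    · rw [ho.neg_pow, norm_neg]
  have h2 := isUnit_one_sub_of_norm_lt_one h1
  have h3 := mul_neg_geom_sum (-Q) (n + 1)
  have hc : Commute (1 - -Q) (∑ i ∈ Finset.range (n + 1), (-Q) ^ i) := by
    rw [commute_iff_eq, h3, geom_sum_mul_neg]
  rw [← h3, hc.isUnit_mul_iff] at h2
  simpa using h2.1

theorem isUnit_one_add_closureARB (h : KernelBounds F η β d) (hs : IsSplitting V W X ε c)
    {p θ : ℝ} (hp : 0 < p) (hθ : 0 ≤ θ) (hθ1 : θ < 1) (h1 : p * (η * c) + β * c ≤ θ * p)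
    (h2 : p * (β * ε) + d * ε ≤ θ) : IsUnit (1 + closureARB h hs) := by
  have hη := h.eta_nonneg
  have hβ := h.beta_nonneg
  have hd0 := h.nonneg
  refine isUnit_one_add_of_norm_pow_le
    (K := (√c / p + √ε) * (p * (η * √c + β * √ε) + (β * √c + d * √ε))) hθ hθ1 fun n => ?_
  refine ContinuousLinearMap.opNorm_le_bound _ (by positivity) fun u => ?_
  obtain ⟨f, s, τ, hf, hle, hd, he⟩ := closureARB_pow_apply h hs hθ h1 h2 n u
  have hs0 : 0 ≤ s := by
    obtain ⟨t, ht⟩ := hf.1.exists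
    exact (norm_nonneg _).trans ht
  have hτ0 : 0 ≤ τ := (norm_nonneg _).trans hf.2
  rw [he, norm_mulOp_eq]
  refine (hs.memLp_matAbsSqrt hf).2.trans ?_
  -- Expanding the right-hand product, the cross terms (√c/p)τ and √ε ps are nonnegative.
  calc √c * s + √ε * τ ≤ (√c / p + √ε) * (p * s + τ) := by
        have e : (√c / p + √ε) * (p * s + τ) =
            √c * s + √ε * τ + (√c / p * τ + √ε * (p * s)) := by
          field_simp
          ring
        rw [e]
        have : 0 ≤ √c / p * τ + √ε * (p * s) := by positivity
        linarith
    _ ≤ (√c / p + √ε) * _ := mul_le_mul_of_nonneg_left hle (by positivity)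
    _ = _ := by ring

/-- The resolvent set criterion for factorized multiplication perturbations of an operator whose
resolvent is given by a convolution kernel. -/
theorem mem_resolventSet_of_kernelBounds {H₀ : Hil →ₗ.[ℂ] Hil} {z : ℂ}
    (hz : z ∈ resolventSet H₀) (h : KernelBounds F η β d)
    (hR : resolvent H₀ z = convOp h.isKernel) (hs : IsSplitting V W X ε c)
    {p θ : ℝ} (hp : 0 < p) (hθ : 0 ≤ θ) (hθ1 : θ < 1) (h1 : p * (η * c) + β * c ≤ θ * p)
    (h2 : p * (β * ε) + d * ε ≤ θ) :
    z ∈ resolventSet (factorizedPerturbation H₀ (mulOp fun t => matAbsSqrt (V t))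
      (mulOp fun t => matPolar (V t) * matAbsSqrt (V t))) := by
  set AR := matAbsSqrtComp hs (convOp h.isKernel) _ _ (isLinfL2_convOp h) with hAR
  have hu := isUnit_one_add_closureARB h hs hp hθ hθ1 h1 h2
  have hRB : ∀ f : (mulOp fun t => matPolar (V t) * matAbsSqrt (V t)).domain,
      resolvent H₀ z (mulOp (fun t => matPolar (V t) * matAbsSqrt (V t)) f) =
        closureRB h hs f := by
    intro f
    rw [hR]
    refine Lp.ext ((coeFn_convOp _ _).trans (Filter.EventuallyEq.trans ?_
      (coeFn_closureRB h hs f).symm))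
    exact Filter.Eventually.of_forall fun x => convK_congr (coeFn_mulOp f) x
  have hARa : ∀ f : Hil, ∃ hd : resolvent H₀ z f ∈ (mulOp fun t => matAbsSqrt (V t)).domain,
      mulOp (fun t => matAbsSqrt (V t)) ⟨resolvent H₀ z f, hd⟩ = AR f := by
    rw [hR]
    exact matAbsSqrtComp_apply hs (convOp h.isKernel) _ _ (isLinfL2_convOp h)
  have hQ := matAbsSqrtComp_apply hs (closureRB h hs) _ _ (isLinfL2_closureRB' h hs)
  refine IsPerturbedResolvent.mem_resolventSet
    (dense_mulOp_domain (hs.measV.matPolar.mul hs.measV.matAbsSqrt))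
    (R := resolvent H₀ z - closureRB h hs ∘L Ring.inverse (1 + closureARB h hs) ∘L AR)
    ⟨hz, AR, closureRB h hs, closureARB h hs, hARa, hRB, fun f => ?_, hu, rfl⟩ fun f hf => ?_
  · rw [hRB]
    exact hQ f
  -- Injectivity: if the formula gives 0 at f, then R₀f = cl(R₀B)g with (1 + Q)g = AR₀f. Applying A
  -- gives AR₀f = Qg, so g = 0, R₀f = 0 and f = 0.
  · set g := Ring.inverse (1 + closureARB h hs) (AR f) with hg
    have e1 : resolvent H₀ z f = closureRB h hs g := sub_eq_zero.1 hf
    obtain ⟨d1, e2⟩ := hARa f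
    obtain ⟨d2, e3⟩ := hQ g
    have e4 : AR f = closureARB h hs g := by
      rw [← e2]
      refine Eq.trans ?_ e3
      congr 1
      exact Subtype.ext e1
    have e5 : g + closureARB h hs g = AR f := by
      have := congrArg (fun L : Hil →L[ℂ] Hil => L (AR f)) (Ring.mul_inverse_cancel _ hu)
      exact this
    have e6 : g = 0 := by rwa [e4, add_eq_right] at e5
    rw [e6, map_zero] at e1
    exact (isResolventAt_resolvent hz).injective e1

end SandwichedResolvent

/-! ### Admissible splittings and the choice of weights. -/

section Potentials

theorem entryMeas_of_memL1AddLinfZero {V : ℝ → Mat2}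
    (hV : ∀ i j, MemL1AddLinfZero (fun t => V t i j)) : EntryMeas V := fun i j => by
  obtain ⟨w, x, hw, hx, -, he⟩ := hV i j
  exact (hw.1.aemeasurable.add hx.1.aemeasurable).congr (Filter.EventuallyEq.symm he)

/-- The bounded part is cut at a radius beyond which every entry is at most ε/4, so that four
entries sum to ε; inside the radius it is integrable. This keeps the infimum in C_ε from being the
default value over an empty set. -/
theorem exists_splitting {V : ℝ → Mat2} (hV : ∀ i j, MemL1AddLinfZero (fun t => V t i j)) {ε : ℝ}
    (hε : 0 < ε) : ∃ W X c, IsSplitting V W X ε c := by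
  have hm := entryMeas_of_memL1AddLinfZero hV
  choose w x hw hx hdec he using hV
  choose r hr using fun i j => hdec i j (ε / 4) (by linarith)
  set r₀ := max (max (r 0 0) (r 0 1)) (max (r 1 0) (r 1 1)) with hr₀
  have hrle : ∀ i j, r i j ≤ r₀ := fun i j => by
    fin_cases i <;> fin_cases j <;> simp [hr₀]
  set S : Set ℝ := {t | r₀ ≤ |t|} with hS
  have hSm : MeasurableSet S := measurableSet_le measurable_const measurable_norm
  have hfin : volume Sᶜ < ⊤ := by
    have : Sᶜ = Set.Ioo (-r₀) r₀ := by
      ext t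
      simp [hS, abs_lt]
    rw [this]
    exact measure_Ioo_lt_top
  refine ⟨fun t => Matrix.of fun i j => w i j t + Sᶜ.indicator (x i j) t,
    fun t => Matrix.of fun i j => S.indicator (x i j) t, _, hε, hm, ?_, fun i j => ?_,
    fun i j => (hx i j).1.indicator hSm, ?_, rfl⟩
  · have he' : ∀ᵐ t, ∀ i j, V t i j = w i j t + x i j t :=
      ae_all_iff.2 fun i => ae_all_iff.2 fun j => he i j
    filter_upwards [he'] with t ht
    ext i j
    rw [ht, Matrix.add_apply, Matrix.of_apply, Matrix.of_apply, add_assoc,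
      Set.indicator_compl_add_self_apply]
  · refine (hw i j).add ((integrable_indicator_iff hSm.compl).2 ?_)
    have : IsFiniteMeasure (volume.restrict Sᶜ) := ⟨by simpa using hfin⟩
    exact ((hx i j).restrict Sᶜ).integrable le_top
  · have hr' : ∀ᵐ t, ∀ i j, r i j ≤ |t| → ‖x i j t‖ ≤ ε / 4 :=
      ae_all_iff.2 fun i => ae_all_iff.2 fun j => hr i j
    filter_upwards [hr'] with t ht
    have hb : ∀ i j, ‖S.indicator (x i j) t‖ ≤ ε / 4 := fun i j => by
      by_cases hts : t ∈ S
      · rw [Set.indicator_of_mem hts]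
        exact ht i j ((hrle i j).trans hts)
      · rw [Set.indicator_of_notMem hts, norm_zero]
        linarith
    refine (norm_matOp_le_sum _).trans ?_
    simp only [Matrix.of_apply]
    linarith [hb 0 0, hb 0 1, hb 1 0, hb 1 1]

/-- Decompositions whose cost is arbitrarily close to `C_ε`. -/
theorem exists_splitting_of_mem_nhds {V : ℝ → Mat2}
    (hV : ∀ i j, MemL1AddLinfZero (fun t => V t i j)) {ε : ℝ} (hε : 0 < ε) {s : Set ℝ}
    (hs : s ∈ nhds (splitCost V ε)) : ∃ W X, ∃ c ∈ s, IsSplitting V W X ε c := by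
  obtain ⟨W₀, X₀, c₀, h₀⟩ := exists_splitting hV hε
  set T := {c : ℝ | ∃ W X : ℝ → Matrix (Fin 2) (Fin 2) ℂ,
    (∀ᵐ t : ℝ, V t = W t + X t) ∧
    (∀ i j, Integrable (fun t => W t i j) volume) ∧
    (∀ i j, AEStronglyMeasurable (fun t => X t i j) volume) ∧
    (∀ᵐ t : ℝ, ‖matOp (X t)‖ ≤ ε) ∧
    c = ∫ t, ‖matOp (W t)‖} with hT
  have hne : T.Nonempty := ⟨c₀, W₀, X₀, h₀.eq, h₀.integrableW, h₀.measX, h₀.le, h₀.cost.symm⟩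
  have hbdd : BddBelow T := by
    refine ⟨0, ?_⟩
    rintro c ⟨W, X, -, -, -, -, rfl⟩
    positivity
  -- Costs lie above their infimum, so only a right half-neighbourhood matters.
  obtain ⟨u, hu, hsub⟩ := exists_Ico_subset_of_mem_nhds hs ⟨_, lt_add_one _⟩
  obtain ⟨c, hc, hcu⟩ := exists_lt_of_csInf_lt hne hu
  obtain ⟨W, X, h1, h2, h3, h4, h5⟩ := hc
  exact ⟨W, X, c, hsub ⟨csInf_le hbdd ⟨W, X, h1, h2, h3, h4, h5⟩, hcu⟩, hε,
    entryMeas_of_memL1AddLinfZero hV, h1, h2, h3, h4, h5.symm⟩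

theorem splitCost_nonneg (V : ℝ → Mat2) (ε : ℝ) : 0 ≤ splitCost V ε := by
  refine Real.sInf_nonneg ?_
  rintro c ⟨W, X, -, -, -, -, rfl⟩
  positivity

theorem kernelBounds_diracKernel {m : ℝ} {z : ℂ} (hz : z ∈ resolventSet (freeDirac m)) {k : ℂ}
    (hk : 0 < k.im) (hkz : k ^ 2 = z ^ 2 - (m : ℂ) ^ 2) :
    KernelBounds (diracKernel m z k) (eta ‖Phi m z‖) (eta ‖Phi m z‖ / √k.im)
      (1 / Metric.infDist z (spectrum (freeDirac m))) := by
  have hc := norm_diracKernel_coeff_le (m := m) (z := z) hk hkz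
  have hη : 0 ≤ eta ‖Phi m z‖ := Real.sqrt_nonneg _
  refine ⟨isKernel_diracKernel hk, one_div_nonneg.2 Metric.infDist_nonneg, fun t => ?_, eLpNorm_expKernel_le hk hc,
    fun f => ?_⟩
  · refine (norm_expKernel_le hc t).trans (mul_le_of_le_one_right hη ?_)
    rw [Real.exp_le_one_iff, neg_nonpos]
    positivity
  · rw [← resolvent_freeDirac_eq hz hk hkz]
    exact ContinuousLinearMap.le_of_opNorm_le _
      ((isResolventAt_resolvent hz).norm_le_of_isStarNormal
        (isStarNormal_resolvent_freeDirac hz hk hkz) (spectrum_freeDirac_nonempty m)) f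

/-- The weights `p` and the rate `θ < 1` for which `p ‖f‖_∞ + ‖f‖₂` contracts. -/
theorem exists_contraction_weights {η κ d c ε : ℝ} (hη : 0 < η) (hκ : 0 < κ) (hd : 0 ≤ d)
    (hε : 0 < ε) (hc0 : 0 ≤ c) (hc : η * c < 1)
    (h : d + η ^ 2 / κ * (c / (1 - η * c)) < 1 / ε) :
    ∃ p θ : ℝ, 0 < p ∧ 0 ≤ θ ∧ θ < 1 ∧ p * (η * c) + η / √κ * c ≤ θ * p ∧
      p * (η / √κ * ε) + d * ε ≤ θ := by
  have hsq : 0 < √κ := Real.sqrt_pos.2 hκ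
  set β := η / √κ with hβ
  have hβ0 : 0 < β := by positivity
  have hβ2 : η ^ 2 / κ = β ^ 2 := by rw [hβ, div_pow, Real.sq_sqrt hκ.le]
  have h1 : 0 < 1 - η * c := by linarith
  rw [hβ2, lt_div_iff₀ hε] at h
  -- The two contraction conditions with θ = 1 bound p below and above by these quotients; the
  -- interval between them is nonempty by `h`.
  have hlt : β * c / (1 - η * c) < (1 - d * ε) / (β * ε) := by
    rw [lt_div_iff₀ (by positivity)]
    have : β * c / (1 - η * c) * (β * ε) = β ^ 2 * (c / (1 - η * c)) * ε := by ring
    rw [this]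
    linarith
  obtain ⟨p, hp1, hp2⟩ := exists_between hlt
  have hp : 0 < p := lt_of_le_of_lt (by positivity) hp1
  rw [div_lt_iff₀ h1] at hp1
  rw [lt_div_iff₀ (by positivity)] at hp2
  -- θ is the larger of the two column ratios of the weighted matrix, both less than 1 by the choice
  -- of p.
  refine ⟨p, max ((p * (η * c) + β * c) / p) (p * (β * ε) + d * ε), hp,
    le_max_of_le_right (by positivity), max_lt ?_ (by linarith), ?_, le_max_right _ _⟩
  · rw [div_lt_one hp]
    linarith
  · rw [← div_le_iff₀ hp]
    exact le_max_left _ _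

end Potentials

end

end DiracSpec

theorem mainTheorem4 (m : ℝ) (hm : 0 ≤ m)
    (V : ℝ → Matrix (Fin 2) (Fin 2) ℂ)
    (hV : ∀ i j, DiracSpec.MemL1AddLinfZero (fun t => V t i j))
    (z : ℂ) (hz : z ∈ DiracSpec.resolventSet (DiracSpec.freeDirac m))
    (h : ∃ ε : ℝ, 0 < ε ∧
      DiracSpec.splitCost V ε < (DiracSpec.eta ‖DiracSpec.Phi m z‖)⁻¹ ∧
      1 / Metric.infDist z (DiracSpec.spectrum (DiracSpec.freeDirac m)) +
          DiracSpec.eta ‖DiracSpec.Phi m z‖ ^ 2 / (DiracSpec.upperSqrt (z ^ 2 - (m : ℂ) ^ 2)).im *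
            (DiracSpec.splitCost V ε /
              (1 - DiracSpec.eta ‖DiracSpec.Phi m z‖ * DiracSpec.splitCost V ε))
        < 1 / ε) :
    z ∉ DiracSpec.spectrum (DiracSpec.diracOp m V) := by
  obtain ⟨ε, hε, h1, h2⟩ := h
  have hk := DiracSpec.upperSqrt_im_pos_of_mem_resolventSet hz
  have hkz := DiracSpec.upperSqrt_sq (z ^ 2 - (m : ℂ) ^ 2)
  have hη : 0 < DiracSpec.eta ‖DiracSpec.Phi m z‖ :=
    inv_pos.1 ((DiracSpec.splitCost_nonneg V ε).trans_lt h1)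
  have hB := DiracSpec.kernelBounds_diracKernel hz hk hkz
  have hR := DiracSpec.resolvent_freeDirac_eq hz hk hkz
  generalize DiracSpec.upperSqrt (z ^ 2 - (m : ℂ) ^ 2) = k at *
  generalize DiracSpec.eta ‖DiracSpec.Phi m z‖ = η at *
  generalize 1 / Metric.infDist z (DiracSpec.spectrum (DiracSpec.freeDirac m)) = d at *
  have h3 : η * DiracSpec.splitCost V ε < 1 := by
    rwa [← lt_inv_mul_iff₀ hη, mul_one]
  -- The infimum C_ε need not be attained; continuity transfers both strict inequalities to the cost
  -- of an actual splitting close to it.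
  have hcont : ContinuousAt (fun c : ℝ => d + η ^ 2 / k.im * (c / (1 - η * c)))
      (DiracSpec.splitCost V ε) := by
    refine continuousAt_const.add (continuousAt_const.mul (ContinuousAt.div continuousAt_id
      (by fun_prop) ?_))
    linarith
  have hcont' : ContinuousAt (fun c : ℝ => η * c) (DiracSpec.splitCost V ε) := by fun_prop
  obtain ⟨W, X, c, ⟨hc1, hc2⟩, hs⟩ := DiracSpec.exists_splitting_of_mem_nhds hV hε
    (((hcont'.tendsto.eventually (gt_mem_nhds h3)).and (hcont.tendsto.eventually (gt_mem_nhds h2))))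
  obtain ⟨p, θ, hp, hθ, hθ1, e1, e2⟩ := DiracSpec.exists_contraction_weights hη hk hB.nonneg hε
    hs.cost_nonneg hc1 hc2
  exact DiracSpec.mem_resolventSet_iff_not_mem_spectrum.1
    (DiracSpec.mem_resolventSet_of_kernelBounds hz hB hR hs hp hθ hθ1 e1 e2)
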